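/- Theorem 2. Let $N=\mathbb R[L_1,L_2,L_3]$ be the algebra of real polynomials on $\mathfrak{su}(2)^*\cong\mathbb R^3$, $\nu$ a formal parameter, $P(F,G)=\sum_{i,j,k}\varepsilon_{ijk}L_k\,\partial_iF\,\partial_jG$ the standard Poisson bracket. Let $\ast$ be the product on $N[\nu]$ that is obtained by restricting the Moyal product $F\ast_MG=\sum_{r\ge0}\frac{\nu^r}{r!}P_M^{(r)}(F,G)$ of $\mathbb R^6$ (where $P_M^{(r)}$ is the $r$-th power of the canonical bracket $P_M(F,G)=\sum_i(\partial_{p_i}F\,\partial_{q_i}G-\partial_{q_i}F\,\partial_{p_i}G)$) to polynomials in the functions $L_i=\sum_{j,k}\varepsilon_{ijk}p_jq_k$. It is well defined, it is invariant ($L_i\ast F-F\ast L_i=2\nu P(L_i,F)$ for $F\in N$), and it is the unique associative, unital, $\mathbb R[\nu]$-bilinear product on $N[\nu]$ with $F\ast G=FG+\nu P(F,G)+O(\nu^2)$ for $F,G\in N$ such that $$L_i\ast F=L_iF+\nu\sum_{j,k}\varepsilon_{ijk}L_k\frac{\partial F}{\partial L_j}+\nu^2\Bigl(2\frac{\partial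 F}{\partial L_i}+\sum_jL_j\frac{\partial^2F}{\partial L_i\partial L_j}\Bigr),\qquad F\in N,\ i=1,2,3.$$ Let $\mathcal S$ be the symmetric tensor algebra of the vector space $N$, let $\tilde T\colon\mathcal S\to N[\nu]$ be the unique linear map with $\tilde T(I)=1$ and $\tilde T(F_1\otimes\cdots\otimes F_k)=\frac1{k!}\sum_{\sigma\in S_k}F_{\sigma_1}\ast\cdots\ast F_{\sigma_k}$, let $\pi\colon N[\nu]\to N$ be evaluation at $\nu=0$, and let $\lambda_0=\lambda\circ\pi$, where $\lambda\colon N\to\mathcal S$ is the linear map with $\lambda(L_{i_1}\cdots L_{i_n})=L_{i_1}\otimes\cdots\otimes L_{i_n}$. The $\odot_\nu$-product associated with $\ast$ is $F\odot_\nu G=\tilde T(\lambda_0(F)\otimes\lambda_0(G))$ for $F,G\in N[\nu]$. Define $\gamma_n,\tau_n$ by the Taylor expansions $1/\cos\alpha=\sum_n\gamma_n\alpha^{2n}$ and $\tan\alpha=\sum_n\tau_n\alpha^{2n+1}$ at $0$, and put $A_k=\sum_{i+j=k}\gamma_i\gamma_j$ and $$z_{p,r}=\sum_{k=p}^rA_{r-k}\sum_{(n_1,\ldots,n_p)}m(n_1,\ldots,n_p)\,\tau_{n_1}\cdots\tau_{n_p},$$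 where the inner sum is over the partitions of $k$ of length $p$ and $m(n_1,\ldots,n_p)$ is the product of the $1/m_j!$ over the multiplicities $m_j$ of the distinct parts. Let $\mathcal D=\sum_kL_k\partial_k$ and $\Delta=\sum_k\partial_k^2$. Then for all $F,G\in N$ $$F\odot_\nu G=FG+\sum_{r\ge1}\nu^{2r}\eta_r(FG),\qquad \eta_r=\Bigl(A_r+\sum_{p=1}^rz_{p,r}\,\mathcal D(\mathcal D-1)\cdots(\mathcal D-p+1)\Bigr)\Delta^r,$$ and each $\eta_r$ is a differential operator on $N$. Call $S_\nu=\sum_{r\ge0}\nu^rS_r$ admissible if $S_0=\mathrm{Id}$ and each $S_r\colon N\to N$, $r\ge1$, is a differential operator. The product $\odot_\nu$ is strongly non-trivial: no admissible $S_\nu$ satisfies $S_\nu(F\odot_\nu G)=S_\nu(F)\cdot S_\nu(G)$ for all $F,G\in N$. It is weakly trivial: some admissible $S_\nu$ satisfies $S_\nu(F\cdot G)=F\odot_\nu G$ for all $F,G\in N$. Finally, there is exactly one map $C^\infty(\mathbb R^3)\times C^\infty(\mathbb R^3)\to C^\infty(\mathbb R^3)[[\nu]]$ whose coefficients in $\nu$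 are bidifferential operators with smooth coefficients and which agrees with $\odot_\nu$ on $N\times N$. It is given by the same formula, with the same differential operators $\eta_r$. Extended to $C^\infty(\mathbb R^3)[[\nu]]$ by annihilating the non-zero powers of $\nu$ in both factors, it extends $\odot_\nu$ from $N[\nu]$ and is a commutative and associative product. -/

import Mathlib

open scoped ContDiff

noncomputable section

namespace Su2

/-! ### Polynomials on `ℝ³`, polynomials on `ℝ⁶`, and the formal parameter -/

/-- The algebra `N` of real polynomials on `ℝ³`, in the coordinates `L₁, L₂, L₃`
(indexed by `0, 1, 2`). -/
abbrev N : Type := MvPolynomial (Fin 3) ℝ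

/-- `N[ν]`; the variable `Polynomial.X` is the deformation parameter `ν`. -/
abbrev Nν : Type := Polynomial N

/-- Real polynomials on `ℝ⁶`, in the coordinates `p₁, p₂, p₃` (`Sum.inl`)
and `q₁, q₂, q₃` (`Sum.inr`). -/
abbrev N6 : Type := MvPolynomial (Fin 3 ⊕ Fin 3) ℝ

/-- Polynomials in `ν` with coefficients in the polynomials on `ℝ⁶`. -/
abbrev N6ν : Type := Polynomial N6

/-- The totally skew-symmetric tensor with `ε₁₂₃ = 1`. -/
def eps (i j k : Fin 3) : ℝ :=
  (((i : ℕ) : ℝ) - ((j : ℕ) : ℝ)) * (((j : ℕ) : ℝ) - ((k : ℕ) : ℝ)) *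
    (((k : ℕ) : ℝ) - ((i : ℕ) : ℝ)) / 2

/-- The coordinate `L_i` on `ℝ³`. -/
def L (i : Fin 3) : N := MvPolynomial.X i

/-- `∂/∂L_i` on polynomials, as a linear map. -/
def dN (i : Fin 3) : Module.End ℝ N := (MvPolynomial.pderiv i : Derivation ℝ N N).toLinearMap

/-- The standard Poisson bracket of `su(2)*`:
`P(F, G) = ∑ ε_{ijk} L_k (∂F/∂L_i) (∂G/∂L_j)`. -/
def poisson (F G : N) : N :=
  ∑ i, ∑ j, ∑ k, eps i j k • (L k * dN i F * dN j G)

/-! ### The Moyal product on `ℝ⁶` and the induced star-product on `ℝ³` -/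

/-- `r`-th power of the canonical Poisson bracket
`∑ (∂F/∂p_i ∂G/∂q_i - ∂F/∂q_i ∂G/∂p_i)` of `ℝ⁶`, as a bidifferential operator. -/
def moyalPow : ℕ → N6 → N6 → N6
  | 0, F, G => F * G
  | r + 1, F, G => ∑ i : Fin 3,
      (moyalPow r (MvPolynomial.pderiv (Sum.inl i) F) (MvPolynomial.pderiv (Sum.inr i) G) -
        moyalPow r (MvPolynomial.pderiv (Sum.inr i) F) (MvPolynomial.pderiv (Sum.inl i) G))

/-- Moyal product `exp(νP)` of two polynomials on `ℝ⁶`. The sum stops because the `r`-th term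
vanishes when `r` exceeds the degree of `F`. -/
def moyal₀ (F G : N6) : N6ν :=
  ∑ r ∈ Finset.range (F.totalDegree + 1),
    Polynomial.monomial r (((Nat.factorial r : ℝ)⁻¹) • moyalPow r F G)

/-- Moyal product, extended `ℝ[ν]`-bilinearly. -/
def moyal (F G : N6ν) : N6ν :=
  F.sum fun i f => G.sum fun j g => Polynomial.X ^ (i + j) * moyal₀ f g

/-- The functions `L_i(p, q) = ∑ ε_{ijk} p_j q_k` on `ℝ⁶`. -/
def L6 (i : Fin 3) : N6 :=
  ∑ j, ∑ k, eps i j k • (MvPolynomial.X (Sum.inl j) * MvPolynomial.X (Sum.inr k))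

/-- `F ↦ F(L₁(p,q), L₂(p,q), L₃(p,q))`, coefficientwise in `ν`. -/
def pull : Nν →+* N6ν := Polynomial.mapRingHom (MvPolynomial.aeval L6 : N →ₐ[ℝ] N6).toRingHom

/-- The star-product on `su(2)* ≅ ℝ³` induced by the Moyal product: `F ∗ G` is the polynomial
whose pullback to `ℝ⁶` is the Moyal product of the pullbacks of `F` and `G`. -/
def star (F G : Nν) : Nν := Function.invFun pull (moyal (pull F) (pull G))

/-- An associative, unital, `ℝ[ν]`-bilinear product on `N[ν]` of the form
`F ∗ G = F G + ν P(F, G) + O(ν²)` for `F, G ∈ N`. -/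
structure IsStarProduct (m : Nν → Nν → Nν) : Prop where
  add_left : ∀ F G H, m (F + G) H = m F H + m G H
  add_right : ∀ F G H, m F (G + H) = m F G + m F H
  smul_left : ∀ (a : ℝ) (F G), m (a • F) G = a • m F G
  smul_right : ∀ (a : ℝ) (F G), m F (a • G) = a • m F G
  nu_left : ∀ F G, m (Polynomial.X * F) G = Polynomial.X * m F G
  nu_right : ∀ F G, m F (Polynomial.X * G) = Polynomial.X * m F G
  assoc : ∀ F G H, m (m F G) H = m F (m G H)
  one_left : ∀ F, m 1 F = F
  one_right : ∀ F, m F 1 = F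
  classical : ∀ F G : N, (m (Polynomial.C F) (Polynomial.C G)).coeff 0 = F * G
  poisson : ∀ F G : N, (m (Polynomial.C F) (Polynomial.C G)).coeff 1 = poisson F G

/-- The formula
`L_i ∗ F = L_i F + ν ∑ ε_{ijk} L_k ∂F/∂L_j + ν² (2 ∂F/∂L_i + ∑ L_j ∂²F/∂L_i∂L_j)`. -/
def HasLProduct (m : Nν → Nν → Nν) : Prop :=
  ∀ (i : Fin 3) (F : N), m (Polynomial.C (L i)) (Polynomial.C F) =
    Polynomial.C (L i * F) +
      Polynomial.X * Polynomial.C (∑ j, ∑ k, eps i j k • (L k * dN j F)) +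
      Polynomial.X ^ 2 * Polynomial.C (2 * dN i F + ∑ j, L j * dN i (dN j F))

/-- Invariance: the star-bracket with a coordinate is the Poisson bracket,
`L_i ∗ F - F ∗ L_i = 2 ν P(L_i, F)`. -/
def IsInvariant (m : Nν → Nν → Nν) : Prop :=
  ∀ (i : Fin 3) (F : N),
    m (Polynomial.C (L i)) (Polynomial.C F) - m (Polynomial.C F) (Polynomial.C (L i)) =
      2 * Polynomial.X * Polynomial.C (poisson (L i) F)

/-! ### The `⊙`-product associated with a product on `N[ν]` -/

/-- `F₁ ∗ (F₂ ∗ (⋯ ∗ F_k))`; the empty product is `1`. -/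
def iterProd (m : Nν → Nν → Nν) {k : ℕ} (F : Fin k → N) : Nν :=
  (List.ofFn fun i => (Polynomial.C (F i) : Nν)).foldr m 1

/-- `T(F₁ ⊗ ⋯ ⊗ F_k) = (1/k!) ∑_σ F_{σ₁} ∗ ⋯ ∗ F_{σ_k}` on the symmetric tensor algebra of the
vector space `N`; for `k = 0` this says `T(I) = 1`. -/
def IsSymmetrization (m : Nν → Nν → Nν) (T : SymmetricAlgebra ℝ N →ₗ[ℝ] Nν) : Prop :=
  ∀ (k : ℕ) (F : Fin k → N),
    T (∏ i, SymmetricAlgebra.ι ℝ N (F i)) =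
      ((Nat.factorial k : ℝ)⁻¹) • ∑ σ : Equiv.Perm (Fin k), iterProd m (fun i => F (σ i))

open Classical in
/-- The map `T̃` (the linear map determined by `IsSymmetrization`). -/
def symMap (m : Nν → Nν → Nν) : SymmetricAlgebra ℝ N →ₗ[ℝ] Nν :=
  if h : ∃ T, IsSymmetrization m T then h.choose else 0

/-- `λ₀`: the projection `N[ν] → N` onto the classical part, followed by the linear map that sends
the monomial `L₁^a L₂^b L₃^c` to the corresponding product of tensor powers of the `L_i`. -/
def lam0 (F : Nν) : SymmetricAlgebra ℝ N :=
  MvPolynomial.aeval (fun i => SymmetricAlgebra.ι ℝ N (L i)) (F.coeff 0)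

/-- The `⊙_ν`-product associated with a product `m` on `N[ν]`:
`F ⊙ G = T̃(λ₀(F) ⊗ λ₀(G))`. -/
def odot (m : Nν → Nν → Nν) (F G : Nν) : Nν := symMap m (lam0 F * lam0 G)

/-! ### Differential operators -/

section DiffOps

variable {A : Type} [CommRing A] [Algebra ℝ A]

/-- `d₁^{α₁} d₂^{α₂} d₃^{α₃}`. -/
def multiDeriv (d : Fin 3 → Module.End ℝ A) (α : Fin 3 → ℕ) : Module.End ℝ A :=
  d 0 ^ α 0 * d 1 ^ α 1 * d 2 ^ α 2

/-- `S = ∑_α c_α ∂^α` (finite sum, coefficients in `A`), where `∂_i` is `d i`. -/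
def IsDiffOp (d : Fin 3 → Module.End ℝ A) (S : A → A) : Prop :=
  ∃ (s : Finset (Fin 3 → ℕ)) (c : (Fin 3 → ℕ) → A),
    ∀ f, S f = ∑ α ∈ s, c α * multiDeriv d α f

/-- `B(f, g) = ∑_{α,β} c_{αβ} ∂^α f ∂^β g` (finite sum, coefficients in `A`). -/
def IsBidiffOp (d : Fin 3 → Module.End ℝ A) (B : A → A → A) : Prop :=
  ∃ (s : Finset ((Fin 3 → ℕ) × (Fin 3 → ℕ))) (c : (Fin 3 → ℕ) × (Fin 3 → ℕ) → A),
    ∀ f g, B f g = ∑ ab ∈ s, c ab * multiDeriv d ab.1 f * multiDeriv d ab.2 g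

/-- The Euler operator `𝒟 = ∑ x_k ∂_k`. -/
def euler (x : Fin 3 → A) (d : Fin 3 → Module.End ℝ A) : Module.End ℝ A :=
  ∑ k, LinearMap.mulLeft ℝ (x k) * d k

/-- The Laplacian `Δ = ∑ ∂_k²`. -/
def laplacian (d : Fin 3 → Module.End ℝ A) : Module.End ℝ A := ∑ k, d k ^ 2

end DiffOps

/-! ### The constants -/

/-- `1 / cos α = ∑ γ_n α^{2n}`. -/
def gam (n : ℕ) : ℝ :=
  iteratedDeriv (2 * n) (fun t : ℝ => (Real.cos t)⁻¹) 0 / (Nat.factorial (2 * n) : ℝ)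

/-- `tan α = ∑ τ_n α^{2n+1}`. -/
def tau (n : ℕ) : ℝ :=
  iteratedDeriv (2 * n + 1) Real.tan 0 / (Nat.factorial (2 * n + 1) : ℝ)

/-- `A_k = ∑_{i+j=k} γ_i γ_j`. -/
def Acoef (k : ℕ) : ℝ := ∑ ij ∈ Finset.HasAntidiagonal.antidiagonal k, gam ij.1 * gam ij.2

/-- `1 / (m₁! ⋯ m_r!)`, where the `m_i` are the multiplicities of the distinct parts. -/
def symFactor {k : ℕ} (π : Nat.Partition k) : ℝ :=
  ∏ a ∈ π.parts.toFinset, ((Nat.factorial (π.parts.count a) : ℝ))⁻¹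

/-- `z_{p,r} = ∑_{k=p}^r A_{r-k} ∑ m(n₁,…,n_p) τ_{n₁} ⋯ τ_{n_p}`, the inner sum over the partitions
`(n₁,…,n_p)` of `k` of length `p`. -/
def zcoef (p r : ℕ) : ℝ :=
  ∑ k ∈ Finset.Icc p r, Acoef (r - k) *
    ∑ π : Nat.Partition k with Multiset.card π.parts = p, symFactor π * (π.parts.map tau).prod

/-- `η_r = (A_r + ∑_{p=1}^r z_{p,r} 𝒟(𝒟-1)⋯(𝒟-p+1)) Δ^r`; here `descPochhammer ℝ p` is the
polynomial `X(X-1)⋯(X-p+1)`. -/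
def eta {A : Type} [CommRing A] [Algebra ℝ A] (x : Fin 3 → A) (d : Fin 3 → Module.End ℝ A)
    (r : ℕ) : Module.End ℝ A :=
  (Acoef r • (1 : Module.End ℝ A) +
    ∑ p ∈ Finset.Icc 1 r, zcoef p r • Polynomial.aeval (euler x d) (descPochhammer ℝ p)) *
  laplacian d ^ r

/-! ### Triviality -/

/-- Action of `S_ν = ∑ ν^r S_r` on `N[[ν]]`. -/
def applySeries (S : ℕ → Module.End ℝ N) (f : PowerSeries N) : PowerSeries N :=
  PowerSeries.mk fun t => ∑ rs ∈ Finset.HasAntidiagonal.antidiagonal t, S rs.1 (PowerSeries.coeff rs.2 f)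

/-- `S_0 = Id`, and `S_r` is a differential operator for `r ≥ 1`. -/
def IsIntertwiner (S : ℕ → Module.End ℝ N) : Prop :=
  S 0 = 1 ∧ ∀ r, 1 ≤ r → IsDiffOp dN (S r)

/-- Strong triviality: `S_ν(F ⊙ G) = S_ν(F) · S_ν(G)` for `F, G ∈ N`. -/
def StronglyTrivial (o : Nν → Nν → Nν) : Prop :=
  ∃ S : ℕ → Module.End ℝ N, IsIntertwiner S ∧ ∀ F G : N,
    applySeries S (o (Polynomial.C F) (Polynomial.C G) : PowerSeries N) =
      applySeries S (PowerSeries.C F) * applySeries S (PowerSeries.C G)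

/-- Weak triviality: `S_ν(F · G) = F ⊙ G` for `F, G ∈ N`. -/
def WeaklyTrivial (o : Nν → Nν → Nν) : Prop :=
  ∃ S : ℕ → Module.End ℝ N, IsIntertwiner S ∧ ∀ F G : N,
    applySeries S (PowerSeries.C (F * G)) =
      (o (Polynomial.C F) (Polynomial.C G) : PowerSeries N)

/-! ### Smooth functions -/

/-- `C^∞(ℝ³)`. -/
def Smooth : Subalgebra ℝ ((Fin 3 → ℝ) → ℝ) where
  carrier := {f | ContDiff ℝ ∞ f}
  mul_mem' {f g} (hf : ContDiff ℝ ∞ f) (hg : ContDiff ℝ ∞ g) := show ContDiff ℝ ∞ (f * g) from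
    hf.mul hg
  add_mem' {f g} (hf : ContDiff ℝ ∞ f) (hg : ContDiff ℝ ∞ g) := show ContDiff ℝ ∞ (f + g) from
    hf.add hg
  algebraMap_mem' a := show ContDiff ℝ ∞ (fun _ : Fin 3 → ℝ => a) from contDiff_const

theorem contDiff_smooth (f : Smooth) : ContDiff ℝ ∞ f.1 := f.2

theorem differentiable_smooth (f : Smooth) : Differentiable ℝ f.1 :=
  (contDiff_smooth f).differentiable (by simp)

/-- `∂/∂L_i` on `C^∞(ℝ³)`. -/
def dS (i : Fin 3) : Module.End ℝ Smooth where
  toFun f := ⟨fun x => fderiv ℝ f.1 x (Pi.single i 1),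
    show ContDiff ℝ ∞ (fun x => fderiv ℝ f.1 x (Pi.single i 1)) from
      ((contDiff_smooth f).fderiv_right (m := ∞) (by exact le_rfl)).clm_apply contDiff_const⟩
  map_add' f g := by
    ext x
    change fderiv ℝ (f.1 + g.1) x (Pi.single i 1) = _
    rw [fderiv_add (differentiable_smooth f x) (differentiable_smooth g x)]
    rfl
  map_smul' a f := by
    ext x
    change fderiv ℝ (a • f.1) x (Pi.single i 1) = _
    rw [fderiv_const_smul (differentiable_smooth f x)]
    rfl

/-- The coordinate function `L_i` in `C^∞(ℝ³)`. -/
def coordS (i : Fin 3) : Smooth :=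
  ⟨fun x => x i, show ContDiff ℝ ∞ (fun x : Fin 3 → ℝ => x i) from contDiff_apply ℝ ℝ i⟩

/-- A polynomial, regarded as a smooth function. -/
def toSmooth : N →ₐ[ℝ] Smooth := MvPolynomial.aeval coordS

/-- `N[ν] → C^∞(ℝ³)[[ν]]`. -/
def embed (F : Nν) : PowerSeries Smooth := PowerSeries.map toSmooth.toRingHom (F : PowerSeries N)

/-- `B : C^∞(ℝ³) × C^∞(ℝ³) → C^∞(ℝ³)[[ν]]` extends the restriction of the product `o` to `N`, and
all its cochains are bidifferential operators with smooth coefficients. -/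
def IsSmoothExtension (o : Nν → Nν → Nν) (B : Smooth → Smooth → PowerSeries Smooth) : Prop :=
  (∀ r, IsBidiffOp dS fun f g => PowerSeries.coeff r (B f g)) ∧
  ∀ F G : N, B (toSmooth F) (toSmooth G) = embed (o (Polynomial.C F) (Polynomial.C G))

/-- The product on `C^∞(ℝ³)[[ν]]` obtained from `B` by annihilating the non-zero powers of `ν` in
the factors. -/
def annihilate (B : Smooth → Smooth → PowerSeries Smooth) (f g : PowerSeries Smooth) :
    PowerSeries Smooth :=
  B (PowerSeries.coeff 0 f) (PowerSeries.coeff 0 g)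

end Su2

end

/-!
# The `⊙`-product of `su(2)*`

*The star-product.* The left Moyal product with a coordinate `x_v` of `ℝ⁶` is
`x_v F + ν {x_v, F}`. The elements `H` with `(H ∗ F) ∗ G = H ∗ (F ∗ G)` for all `F`, `G` contain the
coordinates (`moyal_assoc_X`) and are closed under the product, so an induction on the degree gives
associativity (`moyal_assoc`). The `L_i` are quadratic, hence `L_i ∗ F` stops at `ν²`, and the chain
rule gives the formula for it (`moyal_L6`). Since `L_i F = L_i ∗ F` up to terms `ν H`, `ν² H'`
with `H`, `H'` of degree at most that of `F`, a second induction on the degree shows both that the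
polynomials in the `L_i` are closed under the Moyal product (`moyal_mem_range`) and that a
star-product is determined by the `L_i ∗ F` (`IsStarProduct.eq_of_hasLProduct`). The pullback to
`ℝ⁶` is injective because cross products fill an open dense set (`comap_injective`).

*The formula for `⊙`.* As `λ` is multiplicative, `F ⊙ G = T̃(λ(F G))`, so only the linear map
`T̃ ∘ λ` (`symPoly`) has to be computed. Splitting off the first factor of a symmetrized product
gives `T̃λ(𝒟 f) = ∑ L_i ∗ T̃λ(∂_i f)` (`symPoly_euler`). On homogeneous `f` of degree `n`, `η_r` is
`e_r(n - 2r) Δ^r` for a scalar `e_r` (`etaScalar`), and the recursion becomes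
`(m + 2r) e_r(m) = m e_r(m - 1) + (m + 2) e_{r-1}(m + 1)` (`etaScalar_rec`). By the multinomial
theorem `e_r(m)` is the coefficient of `α^{2r}` in `(tan α / α)^m / cos² α`
(`etaScalar_natCast`), and the recursion is the formula for the derivative of
`tan^m α / cos² α`.

*Triviality.* `S_{2r} = η_r` gives weak triviality. A strong trivialization would force
`η_1 = 0`, by taking `F = 1`, but `η_1(L_1²) = 2` (`not_stronglyTrivial`).

*Smooth functions.* A bidifferential operator at a point depends on finitely many derivatives of the
arguments, which can be realized by polynomials (`exists_polynomial_multiDeriv`). This gives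
uniqueness of the extension; existence holds because `η_r` is a differential operator with
polynomial coefficients. The extension depends only on the product of the classical parts of its
arguments, which makes it commutative and associative.
-/

noncomputable section

namespace Su2

/-! ### Differential and bidifferential operators -/

section DiffOps

variable {A : Type} [CommRing A] [Algebra ℝ A]

/-- A triple of commuting derivations of the algebra `A`, given as linear maps. -/
structure IsPartials (d : Fin 3 → Module.End ℝ A) : Prop where
  leibniz : ∀ i a b, d i (a * b) = d i a * b + a * d i b
  comm : ∀ i j, Commute (d i) (d j)

/-- The `A`-module of differential operators, spanned by the `∂^α`. -/
def diffOps (d : Fin 3 → Module.End ℝ A) : Submodule A (Module.End ℝ A) :=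
  Submodule.span A (Set.range (multiDeriv d))

/-- The `A`-module of bidifferential operators, spanned by the maps `(f, g) ↦ ∂^α f ∂^β g`. -/
def bidiffOps (d : Fin 3 → Module.End ℝ A) : Submodule A (A → A → A) :=
  Submodule.span A (Set.range fun (ab : (Fin 3 → ℕ) × (Fin 3 → ℕ)) f g =>
    multiDeriv d ab.1 f * multiDeriv d ab.2 g)

variable {d : Fin 3 → Module.End ℝ A}

theorem isDiffOp_of_mem {S : Module.End ℝ A} (hS : S ∈ diffOps d) : IsDiffOp d S := by
  obtain ⟨c, rfl⟩ := Finsupp.mem_span_range_iff_exists_finsupp.1 hS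
  exact ⟨c.support, c, fun f => by simp [Finsupp.sum, LinearMap.sum_apply]⟩

theorem isBidiffOp_of_mem {B : A → A → A} (hB : B ∈ bidiffOps d) : IsBidiffOp d B := by
  obtain ⟨c, rfl⟩ := Finsupp.mem_span_range_iff_exists_finsupp.1 hB
  exact ⟨c.support, c, fun f g => by simp [Finsupp.sum, mul_assoc]⟩

theorem multiDeriv_mem (α : Fin 3 → ℕ) : multiDeriv d α ∈ diffOps d :=
  Submodule.subset_span ⟨α, rfl⟩

theorem multiDeriv_zero : multiDeriv d 0 = 1 := by simp [multiDeriv]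

namespace IsPartials

theorem mul_multiDeriv (hd : IsPartials d) (i : Fin 3) (α : Fin 3 → ℕ) :
    d i * multiDeriv d α = multiDeriv d (α + Pi.single i 1) := by
  have h1 := ((hd.comm 1 0).pow_right (α 0)).eq
  have h2 := ((hd.comm 2 0).pow_right (α 0)).eq
  have h3 := ((hd.comm 2 1).pow_right (α 1)).eq
  fin_cases i
  · simp [multiDeriv, pow_succ', mul_assoc]
  · simp only [multiDeriv, Fin.mk_one, Pi.add_apply, Pi.single_apply]
    simp only [← mul_assoc, h1]
    simp [pow_succ', mul_assoc]
  · simp only [multiDeriv, Fin.reduceFinMk, Pi.add_apply, Pi.single_apply]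
    simp only [← mul_assoc, h2]
    simp only [mul_assoc]
    rw [← mul_assoc (d 2), h3]
    simp [pow_succ', mul_assoc]

theorem partial_mul_mem (hd : IsPartials d) (i : Fin 3) {S : Module.End ℝ A}
    (hS : S ∈ diffOps d) : d i * S ∈ diffOps d := by
  induction hS using Submodule.span_induction with
  | mem x hx =>
    obtain ⟨α, rfl⟩ := hx
    rw [hd.mul_multiDeriv]
    exact multiDeriv_mem _
  | zero => simp
  | add x y _ _ hx hy => rw [mul_add]; exact add_mem hx hy
  | smul a x hx hx' =>
    have : d i * (a • x) = d i a • x + a • (d i * x) := by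
      ext f
      simp [hd.leibniz]
    rw [this]
    exact add_mem (Submodule.smul_mem _ _ hx) (Submodule.smul_mem _ _ hx')

theorem partial_pow_mul_mem (hd : IsPartials d) (i : Fin 3) (n : ℕ) {S : Module.End ℝ A}
    (hS : S ∈ diffOps d) : d i ^ n * S ∈ diffOps d := by
  induction n with
  | zero => simpa using hS
  | succ n ih => rw [pow_succ', mul_assoc]; exact hd.partial_mul_mem i ih

theorem mul_mem (hd : IsPartials d) {S S' : Module.End ℝ A} (hS : S ∈ diffOps d)
    (hS' : S' ∈ diffOps d) : S * S' ∈ diffOps d := by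
  induction hS using Submodule.span_induction with
  | mem x hx =>
    obtain ⟨α, rfl⟩ := hx
    rw [multiDeriv, mul_assoc, mul_assoc]
    exact hd.partial_pow_mul_mem _ _ (hd.partial_pow_mul_mem _ _ (hd.partial_pow_mul_mem _ _ hS'))
  | zero => simp
  | add x y _ _ hx hy => rw [add_mul]; exact add_mem hx hy
  | smul a x hx hx' =>
    have : (a • x) * S' = a • (x * S') := rfl
    rw [this]
    exact Submodule.smul_mem _ _ hx'

/-- The differential operators form an algebra under composition. -/
def diffAlg (hd : IsPartials d) : Subalgebra ℝ (Module.End ℝ A) where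
  carrier := diffOps d
  mul_mem' := hd.mul_mem
  add_mem' := add_mem
  algebraMap_mem' r := by
    have : algebraMap ℝ (Module.End ℝ A) r = algebraMap ℝ A r • multiDeriv d 0 := by
      ext f
      simp [multiDeriv_zero, Algebra.smul_def]
    rw [this]
    exact Submodule.smul_mem _ _ (multiDeriv_mem _)

theorem partial_mem (hd : IsPartials d) (i : Fin 3) : d i ∈ hd.diffAlg := by
  have h1 : (1 : Module.End ℝ A) ∈ diffOps d := multiDeriv_zero (d := d) ▸ multiDeriv_mem 0
  change d i ∈ diffOps d
  simpa using hd.partial_mul_mem i h1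

theorem euler_mem (hd : IsPartials d) (x : Fin 3 → A) : euler x d ∈ hd.diffAlg :=
  sum_mem fun i _ => Submodule.smul_mem (diffOps d) (x i) (hd.partial_mem i)

theorem laplacian_mem (hd : IsPartials d) : laplacian d ∈ hd.diffAlg :=
  sum_mem fun i _ => pow_mem (hd.partial_mem i) 2

theorem eta_mem (hd : IsPartials d) (x : Fin 3 → A) (r : ℕ) : eta x d r ∈ diffOps d := by
  change _ ∈ hd.diffAlg
  refine Subalgebra.mul_mem _ (add_mem (Subalgebra.smul_mem _ (one_mem _) _)
    (sum_mem fun p _ => Subalgebra.smul_mem _ ?_ _)) (pow_mem hd.laplacian_mem r)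
  rw [Polynomial.aeval_eq_sum_range]
  exact sum_mem fun k _ => Subalgebra.smul_mem _ (pow_mem (hd.euler_mem x) k) _

theorem comp_mem_bidiffOps (hd : IsPartials d) (i : Fin 3) {B : A → A → A}
    (hB : B ∈ bidiffOps d) : (fun f g => d i (B f g)) ∈ bidiffOps d := by
  induction hB using Submodule.span_induction with
  | mem x hx =>
    obtain ⟨⟨α, β⟩, rfl⟩ := hx
    have : (fun f g => d i (multiDeriv d α f * multiDeriv d β g)) =
        (fun f g => multiDeriv d (α + Pi.single i 1) f * multiDeriv d β g) +
        (fun f g => multiDeriv d α f * multiDeriv d (β + Pi.single i 1) g) := by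
      ext f g
      simp [hd.leibniz, ← hd.mul_multiDeriv]
    rw [this]
    exact add_mem (Submodule.subset_span ⟨(_, _), rfl⟩) (Submodule.subset_span ⟨(_, _), rfl⟩)
  | zero =>
    simp only [Pi.zero_apply, map_zero]
    exact (bidiffOps d).zero_mem
  | add x y _ _ hx hy =>
    simp only [Pi.add_apply, map_add]
    exact add_mem hx hy
  | smul a x hx hx' =>
    simp only [Pi.smul_apply, smul_eq_mul, hd.leibniz]
    exact add_mem (Submodule.smul_mem _ (d i a) hx) (Submodule.smul_mem _ a hx')

theorem comp_pow_mem_bidiffOps (hd : IsPartials d) (i : Fin 3) (n : ℕ) {B : A → A → A}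
    (hB : B ∈ bidiffOps d) : (fun f g => (d i ^ n) (B f g)) ∈ bidiffOps d := by
  induction n with
  | zero => simpa using hB
  | succ n ih =>
    simp only [pow_succ', Module.End.mul_apply]
    exact hd.comp_mem_bidiffOps i ih

/-- A differential operator applied to a product is a bidifferential operator. -/
theorem comp_mul_mem_bidiffOps (hd : IsPartials d) {S : Module.End ℝ A}
    (hS : S ∈ diffOps d) : (fun f g => S (f * g)) ∈ bidiffOps d := by
  induction hS using Submodule.span_induction with
  | mem x hx =>
    obtain ⟨α, rfl⟩ := hx
    refine hd.comp_pow_mem_bidiffOps _ _ (hd.comp_pow_mem_bidiffOps _ _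
      (hd.comp_pow_mem_bidiffOps _ _ (Submodule.subset_span ⟨(0, 0), ?_⟩)))
    simp [multiDeriv_zero]
  | zero => exact (bidiffOps d).zero_mem
  | add x y _ _ hx hy => exact add_mem hx hy
  | smul a x hx hx' => exact Submodule.smul_mem _ a hx'

end IsPartials

/-! ### Behaviour of `η_r` under algebra homomorphisms -/

variable {A' : Type} [CommRing A'] [Algebra ℝ A'] {d' : Fin 3 → Module.End ℝ A'}

theorem map_endPow (φ : A →ₐ[ℝ] A') {S : Module.End ℝ A} {S' : Module.End ℝ A'}
    (h : ∀ a, φ (S a) = S' (φ a)) (n : ℕ) (a : A) : φ ((S ^ n) a) = (S' ^ n) (φ a) := by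
  induction n generalizing a with
  | zero => simp
  | succ n ih => simp [pow_succ, ih, h]

theorem map_multiDeriv (φ : A →ₐ[ℝ] A') (h : ∀ i a, φ (d i a) = d' i (φ a))
    (α : Fin 3 → ℕ) (a : A) : φ (multiDeriv d α a) = multiDeriv d' α (φ a) := by
  have hp : ∀ i n a, φ ((d i ^ n) a) = (d' i ^ n) (φ a) := fun i => map_endPow φ (h i)
  simp [multiDeriv, hp]

theorem map_eta (φ : A →ₐ[ℝ] A') (h : ∀ i a, φ (d i a) = d' i (φ a)) (x : Fin 3 → A)
    (r : ℕ) (a : A) : φ (eta x d r a) = eta (fun i => φ (x i)) d' r (φ a) := by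
  have heul : ∀ a, φ (euler x d a) = euler (fun i => φ (x i)) d' (φ a) := by
    simp [euler, LinearMap.sum_apply, h]
  have hlap : ∀ a, φ (laplacian d a) = laplacian d' (φ a) := by
    simp [laplacian, LinearMap.sum_apply, pow_two, h]
  simp [eta, LinearMap.sum_apply, Polynomial.aeval_eq_sum_range,
    map_endPow φ heul, map_endPow φ hlap]

end DiffOps

/-! ### The Taylor coefficients of `1 / cos` and `tan` -/

/-- The Taylor coefficients at `0` of a real function. -/
def taylorCoeff (f : ℝ → ℝ) (n : ℕ) : ℝ := iteratedDeriv n f 0 / (Nat.factorial n : ℝ)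

theorem taylorCoeff_mul {f g : ℝ → ℝ} (hf : ContDiffAt ℝ ∞ f 0) (hg : ContDiffAt ℝ ∞ g 0)
    (n : ℕ) : taylorCoeff (f * g) n =
      ∑ ij ∈ Finset.HasAntidiagonal.antidiagonal n, taylorCoeff f ij.1 * taylorCoeff g ij.2 := by
  have hle : ((n : ℕ) : WithTop ℕ∞) ≤ ∞ := by exact_mod_cast le_top
  rw [taylorCoeff, iteratedDeriv_mul (hf.of_le hle) (hg.of_le hle),
    Finset.Nat.sum_antidiagonal_eq_sum_range_succ_mk, Finset.sum_div]
  refine Finset.sum_congr rfl fun i hi => ?_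
  have hi' : i ≤ n := Nat.lt_succ_iff.1 (Finset.mem_range.1 hi)
  rw [taylorCoeff, taylorCoeff, Nat.cast_choose ℝ hi']
  have h1 : (Nat.factorial n : ℝ) ≠ 0 := by positivity
  field_simp

theorem sum_antidiagonal_double {c d : ℕ → ℝ} (hc : ∀ n, c (2 * n + 1) = 0) (n : ℕ) :
    ∑ ij ∈ Finset.HasAntidiagonal.antidiagonal (2 * n), c ij.1 * d ij.2 =
      ∑ ij ∈ Finset.HasAntidiagonal.antidiagonal n, c (2 * ij.1) * d (2 * ij.2) := by
  symm
  refine Finset.sum_bij_ne_zero (fun ij _ _ => (2 * ij.1, 2 * ij.2)) ?_ ?_ ?_ (by simp)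
  · simp only [Finset.HasAntidiagonal.mem_antidiagonal]
    omega
  · simp only [Prod.mk.injEq]
    intro a _ _ b _ _ h
    ext <;> omega
  · rintro ⟨i, j⟩ h h0
    rcases Nat.even_or_odd' i with ⟨k, rfl | rfl⟩
    · simp only [Finset.HasAntidiagonal.mem_antidiagonal] at h
      obtain ⟨l, rfl⟩ : ∃ l, j = 2 * l := ⟨n - k, by omega⟩
      exact ⟨(k, l), by simp only [Finset.HasAntidiagonal.mem_antidiagonal]; omega, h0, rfl⟩
    · simp [hc] at h0

theorem sum_antidiagonal_double_odd {c d : ℕ → ℝ} (hc : ∀ n, c (2 * n) = 0) (n : ℕ) :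
    ∑ ij ∈ Finset.HasAntidiagonal.antidiagonal (2 * n + 2), c ij.1 * d ij.2 =
      ∑ ij ∈ Finset.HasAntidiagonal.antidiagonal n, c (2 * ij.1 + 1) * d (2 * ij.2 + 1) := by
  symm
  refine Finset.sum_bij_ne_zero (fun ij _ _ => (2 * ij.1 + 1, 2 * ij.2 + 1)) ?_ ?_ ?_ (by simp)
  · simp only [Finset.HasAntidiagonal.mem_antidiagonal]
    omega
  · simp only [Prod.mk.injEq]
    intro a _ _ b _ _ h
    ext <;> omega
  · rintro ⟨i, j⟩ h h0
    rcases Nat.even_or_odd' i with ⟨k, rfl | rfl⟩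
    · simp [hc] at h0
    · simp only [Finset.HasAntidiagonal.mem_antidiagonal] at h
      obtain ⟨l, rfl⟩ : ∃ l, j = 2 * l + 1 := ⟨n - k, by omega⟩
      exact ⟨(k, l), by simp only [Finset.HasAntidiagonal.mem_antidiagonal]; omega, h0, rfl⟩

theorem taylorCoeff_secant_odd (n : ℕ) : taylorCoeff (fun t => (Real.cos t)⁻¹) (2 * n + 1) = 0 := by
  have h := iteratedDeriv_comp_neg (2 * n + 1) (fun t => (Real.cos t)⁻¹) 0
  simp only [Real.cos_neg, neg_zero, Odd.neg_one_pow ⟨n, rfl⟩, smul_eq_mul] at h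
  rw [taylorCoeff, show iteratedDeriv (2 * n + 1) (fun t => (Real.cos t)⁻¹) 0 = 0 by linarith,
    zero_div]

theorem taylorCoeff_tan_even (n : ℕ) : taylorCoeff Real.tan (2 * n) = 0 := by
  have h := iteratedDeriv_comp_neg (2 * n) Real.tan 0
  have hneg : (fun t => Real.tan (-t)) = -Real.tan := by ext t; simp
  rw [hneg, iteratedDeriv_neg] at h
  simp only [neg_zero, Even.neg_one_pow ⟨n, two_mul n⟩, one_smul] at h
  rw [taylorCoeff, show iteratedDeriv (2 * n) Real.tan 0 = 0 by linarith, zero_div]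

theorem contDiffAt_tan_zero : ContDiffAt ℝ ∞ Real.tan 0 :=
  Real.contDiffAt_tan.2 (by simp)

theorem contDiffAt_secant_zero : ContDiffAt ℝ ∞ (fun t => (Real.cos t)⁻¹) 0 :=
  Real.contDiff_cos.contDiffAt.inv (by simp)

theorem eventually_cos_ne_zero : ∀ᶠ t in nhds (0 : ℝ), Real.cos t ≠ 0 :=
  Real.continuous_cos.continuousAt.eventually_ne (by simp)

theorem taylorCoeff_deriv (f : ℝ → ℝ) (n : ℕ) :
    taylorCoeff (deriv f) n = (n + 1) * taylorCoeff f (n + 1) := by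
  rw [taylorCoeff, taylorCoeff, iteratedDeriv_succ', Nat.factorial_succ]
  have h1 : (Nat.factorial n : ℝ) ≠ 0 := by positivity
  push_cast
  field_simp

/-- The derivative of `tan` is `1 / cos²`, in terms of Taylor coefficients. -/
theorem Acoef_eq_tau (n : ℕ) : Acoef n = (2 * n + 1) * tau n := by
  have h : deriv Real.tan =ᶠ[nhds 0]
      (fun t => (Real.cos t)⁻¹) * (fun t => (Real.cos t)⁻¹) := by
    filter_upwards with t
    simp [Real.deriv_tan, pow_two]
  have h1 : taylorCoeff (deriv Real.tan) (2 * n) = Acoef n := by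
    rw [taylorCoeff, h.iteratedDeriv_eq]
    refine (taylorCoeff_mul contDiffAt_secant_zero contDiffAt_secant_zero _).trans ?_
    exact sum_antidiagonal_double taylorCoeff_secant_odd n
  rw [← h1, taylorCoeff_deriv]
  push_cast
  rfl

theorem Acoef_zero : Acoef 0 = 1 := by simp [Acoef, gam]

theorem tau_zero : tau 0 = 1 := by
  have h := Acoef_eq_tau 0
  rw [Acoef_zero] at h
  simpa using h.symm

/-- The identity `1 / cos² = 1 + tan²`, in terms of Taylor coefficients. -/
theorem Acoef_succ (n : ℕ) :
    Acoef (n + 1) = ∑ ij ∈ Finset.HasAntidiagonal.antidiagonal n, tau ij.1 * tau ij.2 := by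
  have h : (fun t => (Real.cos t)⁻¹) * (fun t => (Real.cos t)⁻¹) =ᶠ[nhds 0]
      fun t => 1 + (Real.tan * Real.tan) t := by
    filter_upwards [eventually_cos_ne_zero] with t ht
    simp only [Pi.mul_apply, Real.tan_eq_sin_div_cos]
    field_simp
    exact (Real.cos_sq_add_sin_sq t).symm
  have h1 : taylorCoeff ((fun t => (Real.cos t)⁻¹) * (fun t => (Real.cos t)⁻¹)) (2 * n + 2) =
      Acoef (n + 1) := by
    rw [taylorCoeff_mul contDiffAt_secant_zero contDiffAt_secant_zero]
    exact sum_antidiagonal_double taylorCoeff_secant_odd (n + 1)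
  have h2 : taylorCoeff (fun t => 1 + (Real.tan * Real.tan) t) (2 * n + 2) =
      taylorCoeff (Real.tan * Real.tan) (2 * n + 2) := by
    rw [taylorCoeff, taylorCoeff, iteratedDeriv_const_add (by omega)]
  rw [← h1, taylorCoeff, h.iteratedDeriv_eq]
  refine h2.trans ((taylorCoeff_mul contDiffAt_tan_zero contDiffAt_tan_zero _).trans ?_)
  exact sum_antidiagonal_double_odd taylorCoeff_tan_even n

/-! ### The generating function of the coefficients of `η_r` -/

/-- The scalar by which the first factor of `η_r` acts on homogeneous polynomials of degree `x`. -/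
def etaScalar (r : ℕ) (x : ℝ) : ℝ :=
  Acoef r + ∑ p ∈ Finset.Icc 1 r, zcoef p r * (descPochhammer ℝ p).eval x

/-- `1 / cos² α = ∑ A_k α^{2k}`, as a power series in `α²`. -/
def secSqSeries : PowerSeries ℝ := PowerSeries.mk Acoef

/-- `tan α / α = ∑ τ_k α^{2k}`, as a power series in `α²`. -/
def tanSeries : PowerSeries ℝ := PowerSeries.mk tau

theorem secSqSeries_eq : secSqSeries = 1 + PowerSeries.X * tanSeries ^ 2 := by
  ext (_ | n)
  · simp [secSqSeries, Acoef_zero]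
  · rw [secSqSeries, PowerSeries.coeff_mk, Acoef_succ, map_add, PowerSeries.coeff_succ_X_mul,
      pow_two, PowerSeries.coeff_mul]
    simp [tanSeries, PowerSeries.coeff_one]

theorem tanSeries_deriv :
    tanSeries + 2 * PowerSeries.X * PowerSeries.derivative ℝ tanSeries = secSqSeries := by
  ext n
  rw [map_add, mul_assoc, secSqSeries, PowerSeries.coeff_mk, Acoef_eq_tau,
    show (2 : PowerSeries ℝ) = PowerSeries.C 2 from (map_ofNat PowerSeries.C 2).symm,
    PowerSeries.coeff_C_mul]
  rcases n with _ | n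
  · simp [tanSeries]
  · rw [PowerSeries.coeff_succ_X_mul, PowerSeries.coeff_derivative]
    simp only [tanSeries, PowerSeries.coeff_mk]
    push_cast
    ring

/-- The sum over the partitions of `k` of length `p` is a coefficient of a divided power. -/
theorem sum_partition_eq (p k : ℕ) :
    (Nat.factorial p : ℝ) * ∑ π : Nat.Partition k with Multiset.card π.parts = p,
        symFactor π * (π.parts.map tau).prod =
      PowerSeries.coeff k ((tanSeries - 1) ^ p) := by
  have htrunc : PowerSeries.trunc (k + 1) (tanSeries - 1) =
      ∑ i ∈ Finset.Icc 1 k, Polynomial.monomial i (tau i) := by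
    ext n
    rw [PowerSeries.coeff_trunc, map_sub, tanSeries, PowerSeries.coeff_mk, PowerSeries.coeff_one]
    simp only [Polynomial.finsetSum_coeff, Polynomial.coeff_monomial, Finset.sum_ite_eq',
      Finset.mem_Icc]
    rcases n with _ | n
    · simp [tau_zero]
    · simp
  have hcoeff : PowerSeries.coeff k ((tanSeries - 1) ^ p) =
      ((∑ i ∈ Finset.Icc 1 k, Polynomial.monomial i (tau i)) ^ p).coeff k := by
    have h := congrArg (fun q => Polynomial.coeff q k)
      (PowerSeries.trunc_trunc_pow (tanSeries - 1) (k + 1) p)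
    simp only [PowerSeries.coeff_trunc, Nat.lt_succ_self, if_true, htrunc] at h
    rw [← h, ← Polynomial.coe_pow, Polynomial.coeff_coe]
  have hprod : ∀ s : Multiset ℕ, (s.map fun i => Polynomial.monomial i (tau i)).prod =
      Polynomial.monomial s.sum (s.map tau).prod := by
    intro s
    induction s using Multiset.induction with
    | empty => simp
    | cons a s ih => simp [ih, Polynomial.monomial_mul_monomial]
  have hperm : ∀ s : Multiset ℕ, (Nat.factorial (Multiset.card s) : ℝ) *
      ∏ a ∈ s.toFinset, ((Nat.factorial (s.count a) : ℝ))⁻¹ = s.countPerms := by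
    intro s
    have h := Nat.multinomial_spec s.toFinset s.count
    rw [Multiset.toFinset_sum_count_eq] at h
    have h' : s.countPerms = Nat.multinomial s.toFinset s.count := by
      rw [Multiset.countPerms, Finsupp.multinomial_eq, Multiset.toFinsupp_support]
      rfl
    rw [h', ← h, Finset.prod_inv_distrib]
    push_cast
    have : ∏ a ∈ s.toFinset, (Nat.factorial (s.count a) : ℝ) ≠ 0 :=
      Finset.prod_ne_zero_iff.2 fun a _ => by positivity
    field_simp
  have hterm : ∀ s : Multiset ℕ, s.sum = k → Multiset.card s = p →
      ((s.countPerms : Polynomial ℝ) *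
          (s.map fun i => Polynomial.monomial i (tau i)).prod).coeff k =
        Nat.factorial p * ((∏ a ∈ s.toFinset, ((Nat.factorial (s.count a) : ℝ))⁻¹) *
          (s.map tau).prod) := by
    rintro s hs rfl
    rw [← Polynomial.C_eq_natCast, Polynomial.coeff_C_mul, hprod, Polynomial.coeff_monomial,
      if_pos hs, ← hperm, mul_assoc]
  rw [hcoeff, Finset.sum_pow, Polynomial.finsetSum_coeff, Finset.mul_sum]
  -- partitions of `k` with `p` parts correspond to the multisets of `p` indices with sum `k`
  refine Finset.sum_bij_ne_zero (fun π hπ _ => ⟨π.parts, (Finset.mem_filter.1 hπ).2⟩) ?_ ?_ ?_ ?_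
  · intro π hπ _
    refine Finset.mem_sym_iff.2 fun a ha => ?_
    exact Finset.mem_Icc.2 ⟨π.parts_pos ha, Nat.Partition.le_of_mem_parts ha⟩
  · intro a _ _ b _ _ h
    exact Nat.Partition.ext (congrArg Subtype.val h)
  · intro s hs h0
    have hsum : s.val.sum = k := by
      by_contra h
      apply h0
      rw [← Polynomial.C_eq_natCast, Polynomial.coeff_C_mul, hprod, Polynomial.coeff_monomial,
        if_neg h, mul_zero]
    refine ⟨⟨s.val, fun {i} hi => (Finset.mem_Icc.1 (Finset.mem_sym_iff.1 hs i hi)).1, hsum⟩,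
      by simp, ?_, rfl⟩
    rw [hterm _ hsum s.2] at h0
    exact h0
  · intro π hπ _
    exact (hterm _ π.parts_sum (Finset.mem_filter.1 hπ).2).symm

theorem coeff_tanSeries_pow_of_lt {p k : ℕ} (h : k < p) :
    PowerSeries.coeff k ((tanSeries - 1) ^ p) = 0 := by
  refine PowerSeries.X_pow_dvd_iff.1 (pow_dvd_pow_of_dvd (PowerSeries.X_dvd_iff.2 ?_) p) k h
  simp [tanSeries, tau_zero]

theorem coeff_secSqSeries_mul_of_lt {p r : ℕ} (h : r < p) :
    PowerSeries.coeff r (secSqSeries * (tanSeries - 1) ^ p) = 0 := by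
  rw [PowerSeries.coeff_mul]
  refine Finset.sum_eq_zero fun ij hij => ?_
  rw [Finset.HasAntidiagonal.mem_antidiagonal] at hij
  rw [coeff_tanSeries_pow_of_lt (by omega), mul_zero]

theorem factorial_mul_zcoef (p r : ℕ) :
    (Nat.factorial p : ℝ) * zcoef p r =
      PowerSeries.coeff r (secSqSeries * (tanSeries - 1) ^ p) := by
  rw [mul_comm secSqSeries, PowerSeries.coeff_mul,
    Finset.Nat.sum_antidiagonal_eq_sum_range_succ_mk, zcoef, Finset.mul_sum]
  refine Finset.sum_subset_zero_on_sdiff ?_ ?_ ?_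
  · intro k hk
    rw [Finset.mem_Icc] at hk
    rw [Finset.mem_range]
    omega
  · intro k hk
    simp only [Finset.mem_sdiff, Finset.mem_range, Finset.mem_Icc] at hk
    rw [coeff_tanSeries_pow_of_lt (by omega), zero_mul]
  · intro k hk
    rw [← sum_partition_eq, secSqSeries, PowerSeries.coeff_mk]
    ring

/-- At a natural number `m`, the scalars are the coefficients of `(1 / cos² α) (tan α / α)^m`;
the binomial expansion of `(1 + (tan α / α - 1))^m` produces the sum over `p`. -/
theorem etaScalar_natCast (r m : ℕ) :
    etaScalar r m = PowerSeries.coeff r (secSqSeries * tanSeries ^ m) := by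
  have hbin : secSqSeries * tanSeries ^ m = ∑ p ∈ Finset.range (m + 1),
      PowerSeries.C (m.choose p : ℝ) * (secSqSeries * (tanSeries - 1) ^ p) := by
    conv_lhs => rw [← sub_add_cancel tanSeries 1, add_pow, Finset.mul_sum]
    refine Finset.sum_congr rfl fun p _ => ?_
    simp only [map_natCast, one_pow]
    ring
  have hz : ∀ p, zcoef p r * (descPochhammer ℝ p).eval (m : ℝ) =
      m.choose p * PowerSeries.coeff r (secSqSeries * (tanSeries - 1) ^ p) := by
    intro p
    rw [descPochhammer_eval_eq_descFactorial, Nat.descFactorial_eq_factorial_mul_choose,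
      ← factorial_mul_zcoef]
    push_cast
    ring
  have h0 : Acoef r = m.choose 0 * PowerSeries.coeff r (secSqSeries * (tanSeries - 1) ^ 0) := by
    simp [secSqSeries]
  have hsplit : ∀ f : ℕ → ℝ, f 0 + ∑ p ∈ Finset.Icc 1 r, f p = ∑ p ∈ Finset.range (r + 1), f p :=
    fun f => by
      rw [Finset.range_eq_Ico, Finset.sum_eq_sum_Ico_succ_bot (Nat.succ_pos r)]
      rfl
  rw [etaScalar, Finset.sum_congr rfl fun p _ => hz p, h0, hbin, map_sum,
    hsplit fun p => (m.choose p : ℝ) * PowerSeries.coeff r (secSqSeries * (tanSeries - 1) ^ p)]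
  simp only [PowerSeries.coeff_C_mul]
  trans ∑ p ∈ Finset.range (max r m + 1),
      (m.choose p : ℝ) * PowerSeries.coeff r (secSqSeries * (tanSeries - 1) ^ p)
  · refine Finset.sum_subset (Finset.range_mono (Nat.succ_le_succ (le_max_left r m))) ?_
    intro p _ hp
    rw [coeff_secSqSeries_mul_of_lt (by simpa using hp), mul_zero]
  · refine (Finset.sum_subset (Finset.range_mono (Nat.succ_le_succ (le_max_right r m))) ?_).symm
    intro p _ hp
    rw [Nat.choose_eq_zero_of_lt (by simpa using hp), Nat.cast_zero, zero_mul]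

theorem secSqSeries_deriv :
    2 * PowerSeries.X * PowerSeries.derivative ℝ secSqSeries =
      2 * PowerSeries.X * tanSeries * secSqSeries := by
  have h : PowerSeries.derivative ℝ secSqSeries =
      tanSeries ^ 2 + 2 * PowerSeries.X * tanSeries * PowerSeries.derivative ℝ tanSeries := by
    rw [secSqSeries_eq]
    simp [Derivation.leibniz, pow_two]
    ring
  rw [h]
  linear_combination 2 * PowerSeries.X * tanSeries * tanSeries_deriv

theorem euler_secSqSeries_mul_tanSeries_pow (n : ℕ) :
    PowerSeries.C (n + 1 : ℝ) * (secSqSeries * tanSeries ^ (n + 1)) +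
        PowerSeries.C 2 *
          (PowerSeries.X * PowerSeries.derivative ℝ (secSqSeries * tanSeries ^ (n + 1))) =
      PowerSeries.C (n + 1 : ℝ) * (secSqSeries * tanSeries ^ n) +
        PowerSeries.C (n + 3 : ℝ) * (PowerSeries.X * (secSqSeries * tanSeries ^ (n + 2))) := by
  have h : PowerSeries.derivative ℝ (secSqSeries * tanSeries ^ (n + 1)) =
      PowerSeries.derivative ℝ secSqSeries * tanSeries ^ (n + 1) +
        (n + 1) * secSqSeries * tanSeries ^ n * PowerSeries.derivative ℝ tanSeries := by
    rw [Derivation.leibniz, Derivation.leibniz_pow]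
    simp
    ring
  rw [h]
  simp only [map_add, map_natCast, map_one, map_ofNat]
  linear_combination tanSeries ^ (n + 1) * secSqSeries_deriv +
    (n + 1 : PowerSeries ℝ) * secSqSeries * tanSeries ^ n * (tanSeries_deriv + secSqSeries_eq)

/-- The recursion that corresponds to
`d/dα (tan^m α / cos² α) = m tan^(m-1) α / cos² α + (m + 2) tan^(m+1) α / cos² α`. -/
theorem etaScalar_rec (r m : ℕ) :
    (m + 2 * (r + 1)) * etaScalar (r + 1) m =
      m * etaScalar (r + 1) (m - 1) + (m + 2) * etaScalar r (m + 1) := by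
  rcases m with _ | n
  · have h := congrArg (PowerSeries.coeff (r + 1)) secSqSeries_deriv
    rw [mul_assoc, mul_assoc, mul_assoc,
      show (2 : PowerSeries ℝ) = PowerSeries.C 2 from (map_ofNat PowerSeries.C 2).symm,
      PowerSeries.coeff_C_mul, PowerSeries.coeff_C_mul, PowerSeries.coeff_succ_X_mul,
      PowerSeries.coeff_succ_X_mul, PowerSeries.coeff_derivative] at h
    have h0 := etaScalar_natCast (r + 1) 0
    have h1 := etaScalar_natCast r 1
    rw [pow_zero, mul_one] at h0
    rw [pow_one, mul_comm] at h1
    rw [← h1, ← h0] at h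
    push_cast at h ⊢
    rw [zero_add, zero_mul, zero_add, zero_add, zero_add]
    linarith
  · have h := congrArg (PowerSeries.coeff (r + 1)) (euler_secSqSeries_mul_tanSeries_pow n)
    rw [(PowerSeries.coeff (r + 1)).map_add, (PowerSeries.coeff (r + 1)).map_add] at h
    simp only [PowerSeries.coeff_C_mul, PowerSeries.coeff_succ_X_mul,
      PowerSeries.coeff_derivative, ← etaScalar_natCast] at h
    push_cast at h ⊢
    rw [add_sub_cancel_right, show (n : ℝ) + 1 + 1 = n + 2 by ring]
    linarith

theorem etaScalar_zero (x : ℝ) : etaScalar 0 x = 1 := by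
  simp [etaScalar, Acoef_zero]

/-! ### The Moyal product -/

/-- The Hamiltonian vector field `{x_v, ·}` of a coordinate of `ℝ⁶`. -/
def ham : Fin 3 ⊕ Fin 3 → Derivation ℝ N6 N6
  | Sum.inl i => MvPolynomial.pderiv (Sum.inr i)
  | Sum.inr i => -MvPolynomial.pderiv (Sum.inl i)

theorem moyalPow_add_left (r : ℕ) (F F' G : N6) :
    moyalPow r (F + F') G = moyalPow r F G + moyalPow r F' G := by
  induction r generalizing F F' G with
  | zero => simp [moyalPow, add_mul]
  | succ r ih =>
    simp only [moyalPow, map_add, ih, ← Finset.sum_add_distrib]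
    exact Finset.sum_congr rfl fun i _ => by ring

theorem moyalPow_add_right (r : ℕ) (F G G' : N6) :
    moyalPow r F (G + G') = moyalPow r F G + moyalPow r F G' := by
  induction r generalizing F G G' with
  | zero => simp [moyalPow, mul_add]
  | succ r ih =>
    simp only [moyalPow, map_add, ih, ← Finset.sum_add_distrib]
    exact Finset.sum_congr rfl fun i _ => by ring

theorem moyalPow_smul_left (r : ℕ) (a : ℝ) (F G : N6) :
    moyalPow r (a • F) G = a • moyalPow r F G := by
  induction r generalizing F G with
  | zero => simp [moyalPow]
  | succ r ih => simp only [moyalPow, Derivation.map_smul, ih, Finset.smul_sum, smul_sub]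

theorem moyalPow_smul_right (r : ℕ) (a : ℝ) (F G : N6) :
    moyalPow r F (a • G) = a • moyalPow r F G := by
  induction r generalizing F G with
  | zero => simp [moyalPow]
  | succ r ih => simp only [moyalPow, Derivation.map_smul, ih, Finset.smul_sum, smul_sub]

/-- The powers of the canonical Poisson bracket, as bilinear maps. -/
def moyalPowHom (r : ℕ) : N6 →ₗ[ℝ] N6 →ₗ[ℝ] N6 :=
  LinearMap.mk₂ ℝ (moyalPow r) (moyalPow_add_left r) (moyalPow_smul_left r)
    (moyalPow_add_right r) (moyalPow_smul_right r)

theorem moyalPow_zero_left (r : ℕ) (G : N6) : moyalPow r 0 G = 0 :=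
  (moyalPowHom r).map_zero₂ G

theorem moyalPow_sum_left {ι : Type} (r : ℕ) (s : Finset ι) (F : ι → N6) (G : N6) :
    moyalPow r (∑ i ∈ s, F i) G = ∑ i ∈ s, moyalPow r (F i) G :=
  (moyalPowHom r).map_sum₂ s F G

theorem moyalPow_neg_right (r : ℕ) (F G : N6) : moyalPow r F (-G) = -moyalPow r F G :=
  (moyalPowHom r F).map_neg G

theorem moyalPow_succ (r : ℕ) (F G : N6) :
    moyalPow (r + 1) F G = ∑ v, moyalPow r (MvPolynomial.pderiv v F) (ham v G) := by
  simp only [moyalPow, Fintype.sum_sum_type, ham, Derivation.neg_apply, moyalPow_neg_right,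
    Finset.sum_add_distrib, Finset.sum_neg_distrib, sub_eq_add_neg]

theorem pderiv_comm {σ : Type} (v w : σ) (F : MvPolynomial σ ℝ) :
    MvPolynomial.pderiv v (MvPolynomial.pderiv w F) =
      MvPolynomial.pderiv w (MvPolynomial.pderiv v F) := by
  classical
  induction F using MvPolynomial.induction_on with
  | C a => simp
  | add F G hF hG => simp [hF, hG]
  | mul_X F i hF =>
    simp only [Derivation.leibniz, map_add, smul_eq_mul, hF, MvPolynomial.pderiv_X,
      Pi.single_apply, apply_ite (MvPolynomial.pderiv _), map_zero,
      MvPolynomial.pderiv_one]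
    split_ifs <;> ring

theorem ham_pderiv (v w : Fin 3 ⊕ Fin 3) (F : N6) :
    ham v (MvPolynomial.pderiv w F) = MvPolynomial.pderiv w (ham v F) := by
  rcases v with v | v <;> simp [ham, pderiv_comm w]

theorem ham_comm (v w : Fin 3 ⊕ Fin 3) (F : N6) : ham v (ham w F) = ham w (ham v F) := by
  rcases w with w | w
  · exact ham_pderiv v _ F
  · change ham v (-MvPolynomial.pderiv _ F) = -MvPolynomial.pderiv _ (ham v F)
    rw [map_neg, ham_pderiv]

theorem moyalPow_one_left (r : ℕ) (G : N6) : moyalPow (r + 1) 1 G = 0 := by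
  simp [moyalPow_succ, moyalPow_zero_left]

theorem moyalPow_swap (r : ℕ) (F G : N6) :
    moyalPow r G F = (-1) ^ r * moyalPow r F G := by
  induction r generalizing F G with
  | zero => simp [moyalPow, mul_comm]
  | succ r ih =>
    simp only [moyalPow, Finset.mul_sum]
    refine Finset.sum_congr rfl fun i _ => ?_
    rw [ih (MvPolynomial.pderiv (Sum.inr i) F), ih (MvPolynomial.pderiv (Sum.inl i) F)]
    ring

/-- The vector fields `{x_v, ·}` are derivations of the powers of the bracket. -/
theorem ham_moyalPow (v : Fin 3 ⊕ Fin 3) (r : ℕ) (F G : N6) :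
    ham v (moyalPow r F G) = moyalPow r (ham v F) G + moyalPow r F (ham v G) := by
  induction r generalizing F G with
  | zero =>
    simp only [moyalPow, Derivation.leibniz, smul_eq_mul]
    ring
  | succ r ih =>
    simp only [moyalPow_succ, map_sum, ih, Finset.sum_add_distrib, ham_pderiv, ham_comm v]

/-- The commutator of the `r`-th power of the bracket with multiplication by a coordinate in the
first argument; it encodes associativity of the Moyal product. -/
theorem moyalPow_X_mul (v : Fin 3 ⊕ Fin 3) (r : ℕ) (F G : N6) :
    moyalPow (r + 1) (MvPolynomial.X v * F) G =
      MvPolynomial.X v * moyalPow (r + 1) F G + (r + 1 : ℝ) • moyalPow r F (ham v G) := by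
  have hd : ∀ (F : N6) w, MvPolynomial.pderiv w (MvPolynomial.X v * F) =
      MvPolynomial.X v * MvPolynomial.pderiv w F + if v = w then F else 0 := by
    intro F w
    by_cases h : v = w
    · subst h; simp
    · simp [h, MvPolynomial.pderiv_X_of_ne h]
  have h0 : ∀ r (F G : N6) w, moyalPow r (if v = w then F else 0) (ham w G) =
      if v = w then moyalPow r F (ham w G) else 0 := by
    intro r F G w
    split_ifs <;> simp [moyalPow_zero_left]
  induction r generalizing F G with
  | zero =>
    simp only [moyalPow_succ (r := 0), hd, moyalPow_add_left, h0, Finset.sum_add_distrib,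
      Finset.sum_ite_eq, Finset.mem_univ, if_true]
    simp only [moyalPow, Finset.mul_sum, mul_assoc, Nat.cast_zero, zero_add, one_smul]
  | succ r ih =>
    rw [moyalPow_succ (r := r + 1), moyalPow_succ (r := r + 1)]
    simp only [hd, moyalPow_add_left, h0, Finset.sum_add_distrib, Finset.sum_ite_eq,
      Finset.mem_univ, if_true]
    simp only [ih, Finset.sum_add_distrib, ← Finset.mul_sum, ← Finset.smul_sum, ham_comm v,
      ← moyalPow_succ]
    push_cast
    module

theorem moyalPow_eq_zero_of_isHomogeneous {r n : ℕ} {F : N6} (hF : F.IsHomogeneous n) (h : n < r)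
    (G : N6) : moyalPow r F G = 0 := by
  induction r generalizing n F G with
  | zero => omega
  | succ r ih =>
    rw [moyalPow_succ]
    refine Finset.sum_eq_zero fun v _ => ?_
    rcases n with _ | n
    · rw [← MvPolynomial.totalDegree_zero_iff_isHomogeneous,
        MvPolynomial.totalDegree_eq_zero_iff_eq_C] at hF
      rw [hF, MvPolynomial.pderiv_C, moyalPow_zero_left]
    · exact ih hF.pderiv (by omega) _

theorem moyalPow_eq_zero {r : ℕ} {F : N6} (h : F.totalDegree < r) (G : N6) :
    moyalPow r F G = 0 := by
  rw [← MvPolynomial.sum_homogeneousComponent F, moyalPow_sum_left]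
  refine Finset.sum_eq_zero fun i hi => ?_
  refine moyalPow_eq_zero_of_isHomogeneous
    (MvPolynomial.homogeneousComponent_isHomogeneous i F) ?_ G
  rw [Finset.mem_range] at hi
  omega

theorem coeff_moyal₀ (F G : N6) (r : ℕ) :
    (moyal₀ F G).coeff r = ((Nat.factorial r : ℝ)⁻¹) • moyalPow r F G := by
  simp only [moyal₀, Polynomial.finsetSum_coeff, Polynomial.coeff_monomial, Finset.sum_ite_eq',
    Finset.mem_range]
  split_ifs with h
  · rfl
  · rw [moyalPow_eq_zero (by omega), smul_zero]

theorem moyal₀_add_left (F F' G : N6) : moyal₀ (F + F') G = moyal₀ F G + moyal₀ F' G := by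
  ext1 r
  simp [coeff_moyal₀, moyalPow_add_left]

theorem moyal₀_add_right (F G G' : N6) : moyal₀ F (G + G') = moyal₀ F G + moyal₀ F G' := by
  ext1 r
  simp [coeff_moyal₀, moyalPow_add_right]

theorem moyal₀_smul_left (a : ℝ) (F G : N6) : moyal₀ (a • F) G = a • moyal₀ F G := by
  ext1 r
  simp [coeff_moyal₀, moyalPow_smul_left, smul_comm a]

theorem moyal₀_smul_right (a : ℝ) (F G : N6) : moyal₀ F (a • G) = a • moyal₀ F G := by
  ext1 r
  simp [coeff_moyal₀, moyalPow_smul_right, smul_comm a]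

theorem moyal₀_zero_left (G : N6) : moyal₀ 0 G = 0 := by
  simpa using moyal₀_smul_left 0 0 G

theorem moyal₀_zero_right (F : N6) : moyal₀ F 0 = 0 := by
  simpa using moyal₀_smul_right 0 F 0

theorem moyal_add_left (F F' G : N6ν) : moyal (F + F') G = moyal F G + moyal F' G := by
  refine Polynomial.sum_add_index _ _ _ (fun i => ?_) (fun i a b => ?_)
  · exact Finset.sum_eq_zero fun j _ => by simp [moyal₀_zero_left]
  · simp [moyal₀_add_left, Polynomial.sum, mul_add, Finset.sum_add_distrib]

theorem moyal_add_right (F G G' : N6ν) : moyal F (G + G') = moyal F G + moyal F G' := by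
  simp only [moyal]
  rw [Polynomial.sum, Polynomial.sum, Polynomial.sum, ← Finset.sum_add_distrib]
  refine Finset.sum_congr rfl fun i _ => Polynomial.sum_add_index _ _ _ (fun j => ?_)
    (fun j a b => ?_)
  · simp [moyal₀_zero_right]
  · simp [moyal₀_add_right, mul_add]

theorem moyal_monomial (i j : ℕ) (f g : N6) :
    moyal (Polynomial.monomial i f) (Polynomial.monomial j g) =
      Polynomial.X ^ (i + j) * moyal₀ f g := by
  rw [moyal, Polynomial.sum_monomial_index, Polynomial.sum_monomial_index]
  · simp [moyal₀_zero_right]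
  · simp [moyal₀_zero_left, Polynomial.sum]

theorem moyal_C (f g : N6) : moyal (Polynomial.C f) (Polynomial.C g) = moyal₀ f g := by
  simpa using moyal_monomial 0 0 f g

theorem moyal_smul_left (a : ℝ) (F G : N6ν) : moyal (a • F) G = a • moyal F G := by
  induction F using Polynomial.induction_on' with
  | add F F' h h' => rw [smul_add, moyal_add_left, moyal_add_left, h, h', smul_add]
  | monomial i f =>
    induction G using Polynomial.induction_on' with
    | add G G' h h' => rw [moyal_add_right, moyal_add_right, h, h', smul_add]
    | monomial j g =>
      rw [Polynomial.smul_monomial, moyal_monomial, moyal_monomial, moyal₀_smul_left,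
        mul_smul_comm]

theorem moyal_smul_right (a : ℝ) (F G : N6ν) : moyal F (a • G) = a • moyal F G := by
  induction F using Polynomial.induction_on' with
  | add F F' h h' => rw [moyal_add_left, moyal_add_left, h, h', smul_add]
  | monomial i f =>
    induction G using Polynomial.induction_on' with
    | add G G' h h' => rw [smul_add, moyal_add_right, moyal_add_right, h, h', smul_add]
    | monomial j g =>
      rw [Polynomial.smul_monomial, moyal_monomial, moyal_monomial, moyal₀_smul_right,
        mul_smul_comm]

theorem moyal_nu_left (F G : N6ν) : moyal (Polynomial.X * F) G = Polynomial.X * moyal F G := by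
  induction F using Polynomial.induction_on' with
  | add F F' h h' => rw [mul_add, moyal_add_left, moyal_add_left, h, h', mul_add]
  | monomial i f =>
    induction G using Polynomial.induction_on' with
    | add G G' h h' => rw [moyal_add_right, moyal_add_right, h, h', mul_add]
    | monomial j g =>
      rw [Polynomial.X_mul_monomial, moyal_monomial, moyal_monomial]
      ring

theorem moyal_nu_right (F G : N6ν) : moyal F (Polynomial.X * G) = Polynomial.X * moyal F G := by
  induction F using Polynomial.induction_on' with
  | add F F' h h' => rw [moyal_add_left, moyal_add_left, h, h', mul_add]
  | monomial i f =>
    induction G using Polynomial.induction_on' with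
    | add G G' h h' => rw [mul_add, moyal_add_right, moyal_add_right, h, h', mul_add]
    | monomial j g =>
      rw [Polynomial.X_mul_monomial, moyal_monomial, moyal_monomial]
      ring

theorem moyal_nu_pow_left (n : ℕ) (F G : N6ν) :
    moyal (Polynomial.X ^ n * F) G = Polynomial.X ^ n * moyal F G := by
  induction n with
  | zero => simp
  | succ n ih => rw [pow_succ', mul_assoc, moyal_nu_left, ih, mul_assoc]

theorem moyal_nu_pow_right (n : ℕ) (F G : N6ν) :
    moyal F (Polynomial.X ^ n * G) = Polynomial.X ^ n * moyal F G := by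
  induction n with
  | zero => simp
  | succ n ih => rw [pow_succ', mul_assoc, moyal_nu_right, ih, mul_assoc]

theorem moyal_one_left (F : N6ν) : moyal 1 F = F := by
  induction F using Polynomial.induction_on' with
  | add F F' h h' => rw [moyal_add_right, h, h']
  | monomial i f =>
    rw [← Polynomial.C_1, ← Polynomial.monomial_zero_left, moyal_monomial, zero_add]
    have : moyal₀ 1 f = Polynomial.C f := by
      ext1 r
      rcases r with _ | r
      · simp [coeff_moyal₀, moyalPow]
      · simp [coeff_moyal₀, moyalPow_one_left, Polynomial.coeff_C_succ]
    rw [this, mul_comm, Polynomial.C_mul_X_pow_eq_monomial]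

theorem moyal_one_right (F : N6ν) : moyal F 1 = F := by
  induction F using Polynomial.induction_on' with
  | add F F' h h' => rw [moyal_add_left, h, h']
  | monomial i f =>
    rw [← Polynomial.C_1, ← Polynomial.monomial_zero_left, moyal_monomial, add_zero]
    have : moyal₀ f 1 = Polynomial.C f := by
      ext1 r
      rcases r with _ | r
      · simp [coeff_moyal₀, moyalPow]
      · simp [coeff_moyal₀, moyalPow_swap (r + 1) 1 f, moyalPow_one_left, Polynomial.coeff_C_succ]
    rw [this, mul_comm, Polynomial.C_mul_X_pow_eq_monomial]

theorem moyal₀_X_left (v : Fin 3 ⊕ Fin 3) (f : N6) :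
    moyal₀ (MvPolynomial.X v) f =
      Polynomial.C (MvPolynomial.X v * f) + Polynomial.X * Polynomial.C (ham v f) := by
  ext1 r
  rw [coeff_moyal₀]
  rcases r with _ | r
  · simp [moyalPow]
  · have h := moyalPow_X_mul v r 1 f
    rw [mul_one, moyalPow_one_left, mul_zero, zero_add] at h
    rw [h]
    rcases r with _ | r
    · simp [moyalPow, Polynomial.coeff_C_succ]
    · simp [moyalPow_one_left, Polynomial.coeff_C_succ]

theorem coeff_zero_moyal_X (v : Fin 3 ⊕ Fin 3) (F : N6ν) :
    (moyal (Polynomial.C (MvPolynomial.X v)) F).coeff 0 = MvPolynomial.X v * F.coeff 0 := by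
  induction F using Polynomial.induction_on' with
  | add F F' h h' =>
    rw [moyal_add_right, Polynomial.coeff_add, h, h', Polynomial.coeff_add, mul_add]
  | monomial i f =>
    rw [← Polynomial.monomial_zero_left, moyal_monomial, moyal₀_X_left]
    rcases i with _ | i
    · simp
    · simp [Polynomial.coeff_monomial]

theorem coeff_succ_moyal_X (v : Fin 3 ⊕ Fin 3) (F : N6ν) (n : ℕ) :
    (moyal (Polynomial.C (MvPolynomial.X v)) F).coeff (n + 1) =
      MvPolynomial.X v * F.coeff (n + 1) + ham v (F.coeff n) := by
  induction F using Polynomial.induction_on' with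
  | add F F' h h' =>
    rw [moyal_add_right, Polynomial.coeff_add, h, h', Polynomial.coeff_add, Polynomial.coeff_add,
      map_add]
    ring
  | monomial i f =>
    rw [← Polynomial.monomial_zero_left, moyal_monomial, moyal₀_X_left, zero_add, mul_add,
      mul_comm _ (Polynomial.C _), Polynomial.C_mul_X_pow_eq_monomial, ← mul_assoc, ← pow_succ,
      mul_comm _ (Polynomial.C _), Polynomial.C_mul_X_pow_eq_monomial]
    simp only [Polynomial.coeff_add, Polynomial.coeff_monomial, Nat.succ_inj, mul_ite, mul_zero,
      apply_ite (ham v), map_zero]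

theorem moyal_assoc_X_C (v : Fin 3 ⊕ Fin 3) (f g : N6) :
    moyal (Polynomial.C (MvPolynomial.X v)) (moyal (Polynomial.C f) (Polynomial.C g)) =
      moyal (moyal (Polynomial.C (MvPolynomial.X v)) (Polynomial.C f)) (Polynomial.C g) := by
  rw [moyal_C f, moyal_C, moyal₀_X_left, moyal_add_left, moyal_nu_left, moyal_C, moyal_C]
  ext1 n
  rcases n with _ | n
  · rw [coeff_zero_moyal_X]
    simp [coeff_moyal₀, moyalPow, mul_assoc]
  · rw [coeff_succ_moyal_X]
    simp only [coeff_moyal₀, Polynomial.coeff_add, Polynomial.coeff_X_mul, moyalPow_X_mul,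
      ham_moyalPow, Derivation.map_smul, smul_add, mul_smul_comm, smul_smul]
    have : ((Nat.factorial (n + 1) : ℝ)⁻¹) * (n + 1) = (Nat.factorial n : ℝ)⁻¹ := by
      rw [Nat.factorial_succ]
      have h1 : (Nat.factorial n : ℝ) ≠ 0 := by positivity
      push_cast
      field_simp
    rw [this]
    abel

/-- Associativity of the Moyal product when the first factor is a coordinate. -/
theorem moyal_assoc_X (v : Fin 3 ⊕ Fin 3) (F G : N6ν) :
    moyal (Polynomial.C (MvPolynomial.X v)) (moyal F G) =
      moyal (moyal (Polynomial.C (MvPolynomial.X v)) F) G := by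
  induction F using Polynomial.induction_on' with
  | add F F' h h' => simp only [moyal_add_left, moyal_add_right, h, h']
  | monomial i f =>
    induction G using Polynomial.induction_on' with
    | add G G' h h' => simp only [moyal_add_right, h, h']
    | monomial j g =>
      rw [← Polynomial.C_mul_X_pow_eq_monomial, ← Polynomial.C_mul_X_pow_eq_monomial,
        mul_comm, mul_comm (Polynomial.C g)]
      simp only [moyal_nu_pow_left, moyal_nu_pow_right, moyal_assoc_X_C]

/-- An induction principle along the degree: a property of polynomials holds if it holds for
constants, is additive, and passes from all polynomials of degree at most `n` to the products of
these with a coordinate. -/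
theorem mvPolynomial_degree_induction {σ : Type} [Fintype σ] {P : MvPolynomial σ ℝ → Prop}
    (hC : ∀ a, P (MvPolynomial.C a)) (hadd : ∀ f g, P f → P g → P (f + g))
    (hX : ∀ n, (∀ m ≤ n, ∀ g : MvPolynomial σ ℝ, g.IsHomogeneous m → P g) →
      ∀ i (f : MvPolynomial σ ℝ), f.IsHomogeneous n → P (MvPolynomial.X i * f))
    (f : MvPolynomial σ ℝ) : P f := by
  have hsum : ∀ {ι : Type} (s : Finset ι) (F : ι → MvPolynomial σ ℝ), (∀ i ∈ s, P (F i)) →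
      P (∑ i ∈ s, F i) := by
    intro ι s F h
    exact Finset.sum_induction F P hadd (by simpa using hC 0) h
  have hhom : ∀ n, ∀ m ≤ n, ∀ g : MvPolynomial σ ℝ, g.IsHomogeneous m → P g := by
    intro n
    induction n with
    | zero =>
      intro m hm g hg
      obtain rfl : m = 0 := by omega
      rw [← MvPolynomial.totalDegree_zero_iff_isHomogeneous,
        MvPolynomial.totalDegree_eq_zero_iff_eq_C] at hg
      rw [hg]
      exact hC _
    | succ n ih =>
      intro m hm g hg
      rcases Nat.lt_or_ge m (n + 1) with h | h
      · exact ih m (by omega) g hg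
      obtain rfl : m = n + 1 := by omega
      have hg' : g = ∑ i, MvPolynomial.X i *
          (MvPolynomial.C ((n + 1 : ℝ)⁻¹) * MvPolynomial.pderiv i g) := by
        have h := hg.sum_X_mul_pderiv
        simp only [mul_left_comm _ (MvPolynomial.C _), ← Finset.mul_sum, h]
        rw [nsmul_eq_mul, ← mul_assoc, ← map_natCast MvPolynomial.C, ← MvPolynomial.C_mul]
        have : ((n : ℝ) + 1)⁻¹ * ((n + 1 : ℕ) : ℝ) = 1 := by
          push_cast
          field_simp
        rw [this, MvPolynomial.C_1, one_mul]
      rw [hg']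
      refine hsum _ _ fun i _ => hX n ih i _ ?_
      have := (MvPolynomial.isHomogeneous_C σ ((n + 1 : ℝ)⁻¹)).mul (hg.pderiv (i := i))
      simpa using this
  rw [← MvPolynomial.sum_homogeneousComponent f]
  exact hsum _ _ fun i _ => hhom i i le_rfl _ (MvPolynomial.homogeneousComponent_isHomogeneous i f)

/-- The Moyal product is associative: the elements `H` with `H ∗ (F ∗ G) = (H ∗ F) ∗ G` for all
`F` and `G` are closed under the product, and the coordinates generate. -/
theorem moyal_assoc (H F G : N6ν) : moyal (moyal H F) G = moyal H (moyal F G) := by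
  have key : ∀ h : N6, ∀ F G, moyal (moyal (Polynomial.C h) F) G =
      moyal (Polynomial.C h) (moyal F G) := by
    intro h
    induction h using mvPolynomial_degree_induction with
    | hC a =>
      intro F G
      have : (Polynomial.C (MvPolynomial.C a) : N6ν) = a • 1 := by
        rw [← MvPolynomial.algebraMap_eq, Algebra.smul_def, mul_one]
        rfl
      rw [this, moyal_smul_left, moyal_smul_left, moyal_one_left, moyal_smul_left, moyal_one_left]
    | hadd f g hf hg =>
      intro F G
      rw [map_add, moyal_add_left, moyal_add_left, hf, hg, moyal_add_left]
    | hX n ih v f hf =>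
      have hham : (ham v f).IsHomogeneous (n - 1) := by
        rcases v with v | v
        · exact hf.pderiv
        · exact hf.pderiv.neg
      intro F G
      have h1 := ih n le_rfl f hf
      have h2 := ih (n - 1) (by omega) _ hham
      have h : (Polynomial.C (MvPolynomial.X v * f) : N6ν) =
          moyal (Polynomial.C (MvPolynomial.X v)) (Polynomial.C f) +
            (-1 : ℝ) • (Polynomial.X * Polynomial.C (ham v f)) := by
        rw [moyal_C, moyal₀_X_left, neg_one_smul]
        ring
      simp only [h, moyal_add_left, moyal_smul_left, moyal_nu_left, ← moyal_assoc_X, h1, h2]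
  induction H using Polynomial.induction_on' with
  | add H H' h h' => simp only [moyal_add_left, h, h']
  | monomial i h =>
    rw [← Polynomial.C_mul_X_pow_eq_monomial, mul_comm]
    simp only [moyal_nu_pow_left, key]

/-! ### Restriction of the Moyal product to the polynomials in the `L_i` -/

/-- The algebra homomorphism `F ↦ F(L₁(p,q), L₂(p,q), L₃(p,q))`. -/
def comap : N →ₐ[ℝ] N6 := MvPolynomial.aeval L6

theorem comap_L (i : Fin 3) : comap (L i) = L6 i := MvPolynomial.aeval_X _ _

theorem L6_zero : L6 0 = MvPolynomial.X (Sum.inl 1) * MvPolynomial.X (Sum.inr 2) -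
    MvPolynomial.X (Sum.inl 2) * MvPolynomial.X (Sum.inr 1) := by
  simp [L6, eps, Fin.sum_univ_three]
  norm_num
  ring

theorem L6_one : L6 1 = MvPolynomial.X (Sum.inl 2) * MvPolynomial.X (Sum.inr 0) -
    MvPolynomial.X (Sum.inl 0) * MvPolynomial.X (Sum.inr 2) := by
  simp [L6, eps, Fin.sum_univ_three]
  norm_num
  ring

theorem L6_two : L6 2 = MvPolynomial.X (Sum.inl 0) * MvPolynomial.X (Sum.inr 1) -
    MvPolynomial.X (Sum.inl 1) * MvPolynomial.X (Sum.inr 0) := by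
  simp [L6, eps, Fin.sum_univ_three]
  norm_num
  ring

theorem pull_C (F : N) : pull (Polynomial.C F) = Polynomial.C (comap F) :=
  Polynomial.map_C _

theorem pull_X : pull Polynomial.X = Polynomial.X := Polynomial.map_X _

/-- The functions `L_i` on `ℝ⁶` are algebraically independent: every vector with non-zero first
coordinate is a cross product. -/
theorem comap_injective : Function.Injective comap := by
  rw [injective_iff_map_eq_zero]
  intro f hf
  have h : MvPolynomial.X 0 * f = 0 := by
    refine MvPolynomial.funext fun x => ?_
    rw [map_mul, MvPolynomial.eval_X, map_zero]
    by_cases hx : x 0 = 0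
    · rw [hx, zero_mul]
    -- the point `(p, q)` satisfies `p × q = x`
    have h1 := congrArg (MvPolynomial.aeval (R := ℝ)
      (Sum.elim ![-x 1, x 0, 0] ![-x 2 / x 0, 0, 1] : Fin 3 ⊕ Fin 3 → ℝ)) hf
    rw [comap, ← AlgHom.comp_apply, MvPolynomial.comp_aeval, map_zero] at h1
    have h2 : (fun i => MvPolynomial.aeval (R := ℝ)
      (Sum.elim ![-x 1, x 0, 0] ![-x 2 / x 0, 0, 1] : Fin 3 ⊕ Fin 3 → ℝ) (L6 i)) = x := by
      ext i
      fin_cases i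
      · simp [L6_zero]
      · simp [L6_one]
      · simp [L6_two]
        field_simp
    rw [h2, MvPolynomial.aeval_eq_eval] at h1
    rw [show MvPolynomial.eval x f = 0 from h1, mul_zero]
  exact (mul_eq_zero.1 h).resolve_left (MvPolynomial.X_ne_zero 0)

theorem pull_injective : Function.Injective pull :=
  Polynomial.map_injective _ comap_injective

theorem derivation_comap (D : Derivation ℝ N6 N6) (F : N) :
    D (comap F) = ∑ a, comap (dN a F) * D (L6 a) := by
  induction F using MvPolynomial.induction_on with
  | C a => simp [dN, comap]
  | add F G hF hG => simp only [map_add, hF, hG, add_mul, Finset.sum_add_distrib]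
  | mul_X F i hF =>
    have h : ∀ a, dN a (F * MvPolynomial.X i) =
        dN a F * L i + if a = i then F else 0 := by
      intro a
      simp only [dN, L, Derivation.coeFn_coe, Derivation.leibniz, smul_eq_mul,
        MvPolynomial.pderiv_X, Pi.single_apply]
      split_ifs <;> simp_all <;> ring
    simp only [map_mul, Derivation.leibniz, hF, h, map_add, add_mul, Finset.sum_add_distrib,
      apply_ite comap, map_zero, ite_mul, zero_mul, Finset.sum_ite_eq', Finset.mem_univ, if_true,
      smul_eq_mul, comap_L, Finset.mul_sum]
    rw [← comap_L, L, add_comm]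
    congr 1
    exact Finset.sum_congr rfl fun a _ => by ring

/-- The operator `∑ ε_{ijk} L_k ∂_j`, that is, `F ↦ P(L_i, F)`. -/
def rotation (i : Fin 3) : Module.End ℝ N :=
  ∑ j, ∑ k, eps i j k • (LinearMap.mulLeft ℝ (L k) * dN j)

/-- The operator `2 ∂_i + ∑ L_j ∂_i ∂_j`. -/
def secondOrder (i : Fin 3) : Module.End ℝ N :=
  (2 : ℝ) • dN i + ∑ j, LinearMap.mulLeft ℝ (L j) * (dN i * dN j)

theorem rotation_apply (i : Fin 3) (F : N) :
    rotation i F = ∑ j, ∑ k, eps i j k • (L k * dN j F) := by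
  simp [rotation, LinearMap.sum_apply]

theorem secondOrder_apply (i : Fin 3) (F : N) :
    secondOrder i F = 2 * dN i F + ∑ j, L j * dN i (dN j F) := by
  simp [secondOrder, LinearMap.sum_apply, two_smul, two_mul]

theorem poisson_L (i : Fin 3) (F : N) : poisson (L i) F = rotation i F := by
  have h : ∀ j, dN j (L i) = if i = j then 1 else 0 := by
    intro j
    simp only [dN, L, Derivation.coeFn_coe, MvPolynomial.pderiv_X, Pi.single_apply]
  simp [poisson, rotation_apply, h, Finset.sum_ite_irrel]

/-- `{L_i, L_j} = ∑ ε_{ijk} L_k` for the canonical bracket of `ℝ⁶`. -/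
theorem moyalPow_one_comap (F G : N) :
    moyalPow 1 (comap F) (comap G) = comap (poisson F G) := by
  simp only [moyalPow, poisson, derivation_comap, Fin.sum_univ_three, L6_zero, L6_one, L6_two,
    map_sub, Derivation.leibniz, MvPolynomial.pderiv_X, Pi.single_apply, eps, map_add, map_smul,
    map_mul, comap_L, smul_eq_mul]
  simp
  norm_num
  ring

theorem moyalPow_two_X_mul_X (v w : Fin 3 ⊕ Fin 3) (G : N6) :
    moyalPow 2 (MvPolynomial.X v * MvPolynomial.X w) G = (2 : ℝ) • ham w (ham v G) := by
  have h1 := moyalPow_X_mul w 1 1 G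
  have h2 := moyalPow_X_mul w 0 1 (ham v G)
  rw [mul_one, moyalPow_one_left, moyalPow_one_left] at h1
  rw [mul_one, moyalPow_one_left] at h2
  rw [moyalPow_X_mul, h1, h2]
  simp [moyalPow]
  norm_num

theorem moyalPow_two_L6 (i : Fin 3) (F : N) :
    moyalPow 2 (L6 i) (comap F) = (2 : ℝ) • comap (secondOrder i F) := by
  have hneg : ∀ A B G : N6, moyalPow 2 (A - B) G = moyalPow 2 A G - moyalPow 2 B G :=
    fun A B G => (moyalPowHom 2).map_sub₂ A B G
  have hc : ∀ a b, dN a (dN b F) = dN b (dN a F) := fun a b => pderiv_comm a b F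
  have hc1 := hc 1 0
  have hc2 := hc 2 0
  have hc3 := hc 2 1
  fin_cases i <;>
  · simp only [Fin.zero_eta, Fin.mk_one, Fin.reduceFinMk, L6_zero, L6_one, L6_two, hneg,
      moyalPow_two_X_mul_X, secondOrder_apply, map_add, map_mul, comap_L, map_sum, map_ofNat,
      two_smul]
    simp only [ham, Derivation.neg_apply, derivation_comap, Fin.sum_univ_three, L6_zero, L6_one,
      L6_two, map_sub, map_add, Derivation.leibniz, MvPolynomial.pderiv_X, Pi.single_apply,
      smul_eq_mul, hc1, hc2, hc3]
    simp
    ring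

theorem L6_isHomogeneous (i : Fin 3) : (L6 i).IsHomogeneous 2 := by
  refine MvPolynomial.IsHomogeneous.sum _ _ _ fun j _ => MvPolynomial.IsHomogeneous.sum _ _ _
    fun k _ => ?_
  rw [MvPolynomial.smul_eq_C_mul]
  have h := (MvPolynomial.isHomogeneous_C (Fin 3 ⊕ Fin 3) (eps i j k)).mul
    ((MvPolynomial.isHomogeneous_X ℝ (Sum.inl j : Fin 3 ⊕ Fin 3)).mul
      (MvPolynomial.isHomogeneous_X ℝ (Sum.inr k : Fin 3 ⊕ Fin 3)))
  simpa using h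

/-- The Moyal product with `L_i`, from the left. -/
theorem moyal_L6 (i : Fin 3) (F : N) :
    moyal (pull (Polynomial.C (L i))) (pull (Polynomial.C F)) =
      pull (Polynomial.C (L i * F) + Polynomial.X * Polynomial.C (rotation i F) +
        Polynomial.X ^ 2 * Polynomial.C (secondOrder i F)) := by
  simp only [map_add, map_mul, map_pow, pull_C, pull_X, moyal_C, comap_L]
  ext1 r
  rw [coeff_moyal₀]
  rcases r with _ | _ | _ | r
  · simp [moyalPow]
  · rw [← comap_L, zero_add, moyalPow_one_comap, poisson_L]
    simp [Polynomial.coeff_C_succ, pow_two, mul_assoc]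
  · rw [zero_add, moyalPow_two_L6, smul_smul]
    simp [Polynomial.coeff_C_succ, pow_two, mul_assoc]
  · rw [moyalPow_eq_zero_of_isHomogeneous (L6_isHomogeneous i) (by omega)]
    simp [Polynomial.coeff_C_succ, pow_two, mul_assoc]

theorem isHomogeneous_L_mul_dN {n : ℕ} {F : N} (hF : F.IsHomogeneous n) (k j : Fin 3) :
    (L k * dN j F).IsHomogeneous n := by
  rcases n with _ | n
  · rw [← MvPolynomial.totalDegree_zero_iff_isHomogeneous,
      MvPolynomial.totalDegree_eq_zero_iff_eq_C] at hF
    rw [hF]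
    simpa [dN] using MvPolynomial.isHomogeneous_zero _ _ _
  · have h := (MvPolynomial.isHomogeneous_X ℝ k).mul (hF.pderiv (i := j))
    rwa [add_comm 1] at h

theorem isHomogeneous_rotation {n : ℕ} {F : N} (hF : F.IsHomogeneous n) (i : Fin 3) :
    (rotation i F).IsHomogeneous n := by
  rw [rotation_apply]
  refine MvPolynomial.IsHomogeneous.sum _ _ _ fun j _ => MvPolynomial.IsHomogeneous.sum _ _ _
    fun k _ => ?_
  rw [MvPolynomial.smul_eq_C_mul]
  simpa using (MvPolynomial.isHomogeneous_C _ _).mul (isHomogeneous_L_mul_dN hF k j)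

theorem isHomogeneous_secondOrder {n : ℕ} {F : N} (hF : F.IsHomogeneous n) (i : Fin 3) :
    (secondOrder i F).IsHomogeneous (n - 1) := by
  rw [secondOrder_apply]
  refine MvPolynomial.IsHomogeneous.add ?_ (MvPolynomial.IsHomogeneous.sum _ _ _ fun j _ => ?_)
  · have h := (MvPolynomial.isHomogeneous_C (Fin 3) (2 : ℝ)).mul (hF.pderiv (i := i))
    rwa [zero_add, map_ofNat] at h
  · rw [show dN i (dN j F) = dN j (dN i F) from pderiv_comm i j F]
    exact isHomogeneous_L_mul_dN hF.pderiv j j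

theorem pull_smul (a : ℝ) (F : Nν) : pull (a • F) = a • pull F := by
  rw [Algebra.smul_def, map_mul, Algebra.smul_def]
  congr 1
  change pull (Polynomial.C (MvPolynomial.C a)) = _
  rw [pull_C, comap, MvPolynomial.aeval_C]
  rfl

theorem coeff_pull (F : Nν) (n : ℕ) : (pull F).coeff n = comap (F.coeff n) :=
  Polynomial.coeff_map _ _

theorem smul_mem_range {y : N6ν} (a : ℝ) (hy : y ∈ pull.range) : a • y ∈ pull.range := by
  obtain ⟨F, rfl⟩ := hy
  exact ⟨a • F, pull_smul a F⟩

theorem X_mem_range : (Polynomial.X : N6ν) ∈ pull.range := ⟨_, pull_X⟩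

theorem moyal_L6_mem_range (i : Fin 3) (F : Nν) :
    moyal (pull (Polynomial.C (L i))) (pull F) ∈ pull.range := by
  induction F using Polynomial.induction_on' with
  | add F F' h h' =>
    rw [map_add, moyal_add_right]
    exact add_mem h h'
  | monomial n f =>
    rw [← Polynomial.C_mul_X_pow_eq_monomial, mul_comm, map_mul, map_pow, pull_X,
      moyal_nu_pow_right, moyal_L6]
    exact mul_mem (pow_mem X_mem_range n) ⟨_, rfl⟩

/-- The Moyal product of two polynomials in the `L_i` is a polynomial in the `L_i`. -/
theorem moyal_mem_range (F G : Nν) : moyal (pull F) (pull G) ∈ pull.range := by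
  have key : ∀ (f : N) (G : Nν), moyal (pull (Polynomial.C f)) (pull G) ∈ pull.range := by
    intro f
    induction f using mvPolynomial_degree_induction with
    | hC a =>
      intro G
      have : pull (Polynomial.C (MvPolynomial.C a)) = a • 1 := by
        rw [pull_C, comap, MvPolynomial.aeval_C, Algebra.smul_def, mul_one]
        rfl
      rw [this, moyal_smul_left, moyal_one_left]
      exact smul_mem_range a ⟨G, rfl⟩
    | hadd f g hf hg =>
      intro G
      rw [map_add, map_add, moyal_add_left]
      exact add_mem (hf G) (hg G)
    | hX n ih i f hf =>
      intro G
      have h : pull (Polynomial.C (MvPolynomial.X i * f)) =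
          moyal (pull (Polynomial.C (L i))) (pull (Polynomial.C f)) +
            ((-1 : ℝ) • (Polynomial.X * pull (Polynomial.C (rotation i f))) +
            (-1 : ℝ) • (Polynomial.X ^ 2 * pull (Polynomial.C (secondOrder i f)))) := by
        rw [moyal_L6, neg_one_smul, neg_one_smul, map_add, map_add, map_mul pull, map_mul pull,
          map_pow, pull_X, L]
        ring
      rw [h, moyal_add_left, moyal_add_left, moyal_smul_left, moyal_smul_left, moyal_nu_left,
        moyal_nu_pow_left, moyal_assoc]
      obtain ⟨H, hH⟩ := ih n le_rfl f hf G
      rw [← hH]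
      exact add_mem (moyal_L6_mem_range i H) (add_mem
        (smul_mem_range _ (mul_mem X_mem_range
          (ih n le_rfl _ (isHomogeneous_rotation hf i) G)))
        (smul_mem_range _ (mul_mem (pow_mem X_mem_range 2)
          (ih (n - 1) (by omega) _ (isHomogeneous_secondOrder hf i) G))))
  induction F using Polynomial.induction_on' with
  | add F F' h h' =>
    rw [map_add, moyal_add_left]
    exact add_mem h h'
  | monomial n f =>
    rw [← Polynomial.C_mul_X_pow_eq_monomial, mul_comm, map_mul, map_pow, pull_X,
      moyal_nu_pow_left]
    exact mul_mem (pow_mem X_mem_range n) (key f G)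

/-! ### The star-product on `su(2)*` -/

theorem pull_star (F G : Nν) : pull (star F G) = moyal (pull F) (pull G) :=
  Function.invFun_eq (moyal_mem_range F G)

theorem star_isStarProduct : IsStarProduct star where
  add_left F G H := pull_injective (by simp only [map_add, pull_star, moyal_add_left])
  add_right F G H := pull_injective (by simp only [map_add, pull_star, moyal_add_right])
  smul_left a F G := pull_injective (by simp only [pull_smul, pull_star, moyal_smul_left])
  smul_right a F G := pull_injective (by simp only [pull_smul, pull_star, moyal_smul_right])
  nu_left F G := pull_injective (by simp only [map_mul, pull_X, pull_star, moyal_nu_left])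
  nu_right F G := pull_injective (by simp only [map_mul, pull_X, pull_star, moyal_nu_right])
  assoc F G H := pull_injective (by simp only [pull_star, moyal_assoc])
  one_left F := pull_injective (by simp only [pull_star, map_one, moyal_one_left])
  one_right F := pull_injective (by simp only [pull_star, map_one, moyal_one_right])
  classical F G := comap_injective (by
    rw [← coeff_pull, pull_star, pull_C, pull_C, moyal_C, coeff_moyal₀]
    simp [moyalPow])
  poisson F G := comap_injective (by
    rw [← coeff_pull, pull_star, pull_C, pull_C, moyal_C, coeff_moyal₀, moyalPow_one_comap]
    simp)

theorem star_L (i : Fin 3) (F : N) :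
    star (Polynomial.C (L i)) (Polynomial.C F) =
      Polynomial.C (L i * F) + Polynomial.X * Polynomial.C (rotation i F) +
        Polynomial.X ^ 2 * Polynomial.C (secondOrder i F) :=
  pull_injective (by rw [pull_star, moyal_L6])

theorem star_hasLProduct : HasLProduct star := fun i F => by
  rw [star_L, rotation_apply, secondOrder_apply]

theorem star_isInvariant : IsInvariant star := by
  intro i F
  refine pull_injective ?_
  rw [map_sub, pull_star, pull_star]
  simp only [map_mul, map_ofNat, pull_X, pull_C, moyal_C]
  ext1 r
  rw [Polynomial.coeff_sub, coeff_moyal₀, coeff_moyal₀, moyalPow_swap r (comap (L i)), mul_assoc,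
    ← map_ofNat Polynomial.C, Polynomial.coeff_C_mul]
  rcases r with _ | _ | _ | r
  · simp
  · rw [zero_add, moyalPow_one_comap]
    simp [two_mul]
  · simp [Polynomial.coeff_C_succ]
  · rw [comap_L, moyalPow_eq_zero_of_isHomogeneous (L6_isHomogeneous i) (by omega)]
    simp [Polynomial.coeff_C_succ]

namespace IsStarProduct

variable {m m' : Nν → Nν → Nν}

theorem nu_pow_left (hm : IsStarProduct m) (n : ℕ) (F G : Nν) :
    m (Polynomial.X ^ n * F) G = Polynomial.X ^ n * m F G := by
  induction n with
  | zero => simp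
  | succ n ih => rw [pow_succ', mul_assoc, hm.nu_left, ih, mul_assoc]

theorem nu_pow_right (hm : IsStarProduct m) (n : ℕ) (F G : Nν) :
    m F (Polynomial.X ^ n * G) = Polynomial.X ^ n * m F G := by
  induction n with
  | zero => simp
  | succ n ih => rw [pow_succ', mul_assoc, hm.nu_right, ih, mul_assoc]

/-- A star-product is determined by its values `L_i ∗ F`: the `L_i` generate. -/
theorem eq_of_hasLProduct (hm : IsStarProduct m) (hL : HasLProduct m) (hm' : IsStarProduct m')
    (hL' : HasLProduct m') : m = m' := by
  have hgen : ∀ i (G : Nν), m (Polynomial.C (L i)) G = m' (Polynomial.C (L i)) G := by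
    intro i G
    induction G using Polynomial.induction_on' with
    | add F F' h h' => rw [hm.add_right, hm'.add_right, h, h']
    | monomial n f =>
      rw [← Polynomial.C_mul_X_pow_eq_monomial, mul_comm, hm.nu_pow_right, hm'.nu_pow_right,
        hL, hL']
  have hsplit : ∀ {m : Nν → Nν → Nν}, IsStarProduct m → HasLProduct m → ∀ i f G,
      m (Polynomial.C (MvPolynomial.X i * f)) G = m (Polynomial.C (L i)) (m (Polynomial.C f) G) +
        ((-1 : ℝ) • (Polynomial.X * m (Polynomial.C (rotation i f)) G) +
        (-1 : ℝ) • (Polynomial.X ^ 2 * m (Polynomial.C (secondOrder i f)) G)) := by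
    intro m hm hL i f G
    have h : (Polynomial.C (MvPolynomial.X i * f) : Nν) =
        m (Polynomial.C (L i)) (Polynomial.C f) +
          ((-1 : ℝ) • (Polynomial.X * Polynomial.C (rotation i f)) +
          (-1 : ℝ) • (Polynomial.X ^ 2 * Polynomial.C (secondOrder i f))) := by
      rw [hL, neg_one_smul, neg_one_smul, rotation_apply, secondOrder_apply]
      simp only [L]
      ring
    rw [h, hm.add_left, hm.add_left, hm.smul_left, hm.smul_left, hm.nu_left, hm.nu_pow_left,
      hm.assoc]
  have key : ∀ (f : N) (G : Nν), m (Polynomial.C f) G = m' (Polynomial.C f) G := by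
    intro f
    induction f using mvPolynomial_degree_induction with
    | hC a =>
      intro G
      have : (Polynomial.C (MvPolynomial.C a) : Nν) = a • 1 := by
        rw [← MvPolynomial.algebraMap_eq, Algebra.smul_def, mul_one]
        rfl
      rw [this, hm.smul_left, hm'.smul_left, hm.one_left, hm'.one_left]
    | hadd f g hf hg =>
      intro G
      rw [map_add, hm.add_left, hm'.add_left, hf, hg]
    | hX n ih i f hf =>
      intro G
      rw [hsplit hm hL, hsplit hm' hL', ih n le_rfl f hf,
        ih n le_rfl _ (isHomogeneous_rotation hf i),
        ih (n - 1) (by omega) _ (isHomogeneous_secondOrder hf i), hgen]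
  funext F G
  induction F using Polynomial.induction_on' with
  | add F F' h h' => rw [hm.add_left, hm'.add_left, h, h']
  | monomial n f =>
    rw [← Polynomial.C_mul_X_pow_eq_monomial, mul_comm, hm.nu_pow_left, hm'.nu_pow_left, key]

end IsStarProduct

/-! ### Symmetrization -/

section Symmetrization

variable {M : Type} [AddCommMonoid M] [Module ℝ M] {A : Type} [Ring A] [Algebra ℝ A]

/-- The symmetrized product `(x₁, …, x_k) ↦ (1/k!) ∑_σ f(x_{σ₁}) ⋯ f(x_{σ_k})`. -/
def symProd (f : M →ₗ[ℝ] A) (k : ℕ) : MultilinearMap ℝ (fun _ : Fin k => M) A :=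
  ((Nat.factorial k : ℝ)⁻¹) • ∑ σ : Equiv.Perm (Fin k),
    ((MultilinearMap.mkPiAlgebraFin ℝ k A).compLinearMap fun _ => f).domDomCongr σ

theorem symProd_apply (f : M →ₗ[ℝ] A) {k : ℕ} (x : Fin k → M) :
    symProd f k x = ((Nat.factorial k : ℝ)⁻¹) •
      ∑ σ : Equiv.Perm (Fin k), (List.ofFn fun i => f (x (σ i))).prod := by
  simp [symProd]

theorem symProd_comp_perm (f : M →ₗ[ℝ] A) {k : ℕ} (x : Fin k → M) (τ : Equiv.Perm (Fin k)) :
    symProd f k (x ∘ τ) = symProd f k x := by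
  rw [symProd_apply, symProd_apply]
  congr 1
  exact Fintype.sum_equiv (Equiv.mulLeft τ) _ _ fun σ => rfl

theorem exists_perm_of_map_eq {κ : Type} {k : ℕ} {F G : Fin k → κ}
    (h : Finset.univ.val.map F = Finset.univ.val.map G) :
    ∃ σ : Equiv.Perm (Fin k), F = G ∘ σ := by
  classical
  have hcard : ∀ (F : Fin k → κ) c, Fintype.card {a // F a = c} =
      (Finset.univ.val.map F).count c := by
    intro F c
    rw [Fintype.card_subtype, Multiset.count_map]
    simp only [eq_comm (a := c)]
    rfl
  have e : ∀ c, Nonempty ({a // F a = c} ≃ {a // G a = c}) := fun c =>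
    ⟨Fintype.equivOfCardEq (by rw [hcard, hcard, h])⟩
  exact ⟨Equiv.ofFiberEquiv fun c => (e c).some,
    funext fun a => (Equiv.ofFiberEquiv_map _ a).symm⟩

theorem symProd_congr (f : M →ₗ[ℝ] A) {κ : Type} (b : κ → M) {k l : ℕ} (F : Fin k → κ)
    (G : Fin l → κ) (h : Finset.univ.val.map F = Finset.univ.val.map G) :
    symProd f k (b ∘ F) = symProd f l (b ∘ G) := by
  have hkl : k = l := by simpa using congrArg Multiset.card h
  subst hkl
  obtain ⟨σ, rfl⟩ := exists_perm_of_map_eq h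
  exact symProd_comp_perm f (b ∘ G) σ

/-- The symmetrized product factors through the symmetric algebra. With respect to a basis of the
vector space, the symmetric algebra is a polynomial ring, and the value on a monomial is the
symmetrized product of its factors in any order. -/
theorem exists_symmetrization [Module.Free ℝ M] (f : M →ₗ[ℝ] A) :
    ∃ T : SymmetricAlgebra ℝ M →ₗ[ℝ] A, ∀ (k : ℕ) (x : Fin k → M),
      T (∏ i, SymmetricAlgebra.ι ℝ M (x i)) = symProd f k x := by
  obtain ⟨κ, b⟩ := Module.Free.exists_basis (R := ℝ) (M := M)
  let l : (κ →₀ ℕ) → List κ := fun s => (Finsupp.toMultiset s).toList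
  let T₀ : MvPolynomial κ ℝ →ₗ[ℝ] A := (MvPolynomial.basisMonomials κ ℝ).constr ℝ
    fun s => symProd f (l s).length (b ∘ (l s).get)
  let T : SymmetricAlgebra ℝ M →ₗ[ℝ] A :=
    T₀ ∘ₗ (SymmetricAlgebra.equivMvPolynomial b).toLinearMap
  refine ⟨T, fun k => ?_⟩
  have key : T.compMultilinearMap ((MultilinearMap.mkPiAlgebra ℝ (Fin k)
      (SymmetricAlgebra ℝ M)).compLinearMap fun _ => SymmetricAlgebra.ι ℝ M) = symProd f k := by
    refine Module.Basis.ext_multilinear (fun _ => b) fun F => ?_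
    have hmon : ∏ i, (MvPolynomial.X (F i) : MvPolynomial κ ℝ) =
        MvPolynomial.basisMonomials κ ℝ (∑ i, Finsupp.single (F i) 1) := by
      simp [MvPolynomial.monomial_sum_one, MvPolynomial.X]
    have hval : T (∏ i, SymmetricAlgebra.ι ℝ M (b (F i))) =
        symProd f _ (b ∘ (l (∑ i, Finsupp.single (F i) 1)).get) := by
      simp only [T, T₀, LinearMap.comp_apply, AlgEquiv.toLinearMap_apply, map_prod,
        SymmetricAlgebra.equivMvPolynomial_ι_apply, hmon, Module.Basis.constr_basis]
    simp only [LinearMap.compMultilinearMap_apply, MultilinearMap.compLinearMap_apply,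
      MultilinearMap.mkPiAlgebra_apply, hval]
    refine symProd_congr f b _ F ?_
    have h1 : (Finset.univ.val.map (l (∑ i, Finsupp.single (F i) 1)).get) =
        Finsupp.toMultiset (∑ i, Finsupp.single (F i) 1) := by
      rw [Fin.univ_val_map, List.ofFn_get, Multiset.coe_toList]
    rw [h1, map_sum]
    simp only [Finsupp.toMultiset_single, one_smul]
    have h2 := Multiset.sum_map_singleton (Finset.univ.val.map F)
    rwa [Multiset.map_map] at h2
  exact fun x => congrArg (fun m => m x) key

/-- A linear map on the symmetric algebra is determined by its values on products of vectors. -/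
theorem symmetricAlgebra_hom_ext {B : Type} [AddCommMonoid B] [Module ℝ B]
    {T T' : SymmetricAlgebra ℝ M →ₗ[ℝ] B}
    (h : ∀ (k : ℕ) (x : Fin k → M), T (∏ i, SymmetricAlgebra.ι ℝ M (x i)) =
      T' (∏ i, SymmetricAlgebra.ι ℝ M (x i))) : T = T' := by
  have htop : ∀ y, y ∈ Algebra.adjoin ℝ (Set.range (SymmetricAlgebra.ι ℝ M)) := by
    intro y
    induction y using SymmetricAlgebra.induction with
    | algebraMap r => exact Subalgebra.algebraMap_mem _ r
    | ι x => exact Algebra.subset_adjoin ⟨x, rfl⟩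
    | mul a b ha hb => exact mul_mem ha hb
    | add a b ha hb => exact add_mem ha hb
  ext y
  have hy := htop y
  rw [← Subalgebra.mem_toSubmodule, Algebra.adjoin_eq_span] at hy
  induction hy using Submodule.span_induction with
  | mem y hy =>
    obtain ⟨l, hl, rfl⟩ := Submonoid.exists_list_of_mem_closure hy
    choose x hx using fun i : Fin l.length => hl (l.get i) (List.get_mem l i)
    have := h l.length x
    simp only [hx] at this
    rwa [← List.prod_ofFn, List.ofFn_get] at this
  | zero => simp
  | add a b _ _ ha hb => rw [map_add, map_add, ha, hb]
  | smul a y _ hy => rw [map_smul, map_smul, hy]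

/-- The symmetrized product, expanded along its first factor. -/
theorem symProd_succ (f : M →ₗ[ℝ] A) {k : ℕ} (x : Fin (k + 1) → M) :
    (k + 1 : ℝ) • symProd f (k + 1) x =
      ∑ a, f (x a) * symProd f k fun i => x (Equiv.swap 0 a i.succ) := by
  simp only [symProd_apply, mul_smul_comm, ← Finset.smul_sum, Finset.mul_sum]
  rw [smul_smul, ← Equiv.Perm.decomposeFin.symm.sum_comp, Fintype.sum_prod_type]
  congr 1
  · rw [Nat.factorial_succ]
    push_cast
    field_simp
  · simp only [List.ofFn_succ, List.prod_cons, Equiv.Perm.decomposeFin_symm_apply_zero,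
      Equiv.Perm.decomposeFin_symm_apply_succ]

end Symmetrization

namespace IsStarProduct

variable {m : Nν → Nν → Nν}

/-- Left multiplication by polynomials. -/
def leftMul (hm : IsStarProduct m) : N →ₗ[ℝ] Module.End ℝ Nν :=
  LinearMap.mk₂ ℝ (fun F G => m (Polynomial.C F) G)
    (fun F F' G => by rw [map_add, hm.add_left])
    (fun a F G => by rw [← Polynomial.smul_C, hm.smul_left])
    (fun F G G' => hm.add_right _ G G')
    (fun a F G => hm.smul_right a _ G)

theorem leftMul_apply (hm : IsStarProduct m) (F : N) (G : Nν) :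
    hm.leftMul F G = m (Polynomial.C F) G := rfl

theorem iterProd_eq (hm : IsStarProduct m) {k : ℕ} (F : Fin k → N) :
    iterProd m F = (List.ofFn fun i => hm.leftMul (F i)).prod 1 := by
  induction k with
  | zero => simp [iterProd]
  | succ k ih =>
    have h := ih fun i => F i.succ
    rw [iterProd] at h ⊢
    rw [List.ofFn_succ, List.ofFn_succ, List.prod_cons, List.foldr_cons, h]
    rfl

theorem symProd_leftMul (hm : IsStarProduct m) {k : ℕ} (F : Fin k → N) :
    symProd (A := Module.End ℝ Nν) hm.leftMul k F 1 = ((Nat.factorial k : ℝ)⁻¹) •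
      ∑ σ : Equiv.Perm (Fin k), iterProd m (fun i => F (σ i)) := by
  simp only [symProd_apply, LinearMap.smul_apply, LinearMap.sum_apply, hm.iterProd_eq]

theorem existsUnique_symmetrization (hm : IsStarProduct m) : ∃! T, IsSymmetrization m T := by
  obtain ⟨T, hT⟩ := exists_symmetrization (A := Module.End ℝ Nν) hm.leftMul
  refine ⟨LinearMap.applyₗ 1 ∘ₗ T, fun k F => ?_, fun T' hT' => ?_⟩
  · rw [LinearMap.comp_apply, hT, ← hm.symProd_leftMul]
    rfl
  · refine symmetricAlgebra_hom_ext fun k F => ?_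
    rw [hT', LinearMap.comp_apply, hT, ← hm.symProd_leftMul]
    rfl

theorem symMap_spec (hm : IsStarProduct m) : IsSymmetrization m (symMap m) := by
  have h := hm.existsUnique_symmetrization.exists
  rw [symMap, dif_pos h]
  exact h.choose_spec

end IsStarProduct

/-! ### The `⊙`-product on polynomials -/

theorem isPartials_dN : IsPartials dN where
  leibniz i a b := by
    change MvPolynomial.pderiv i (a * b) = _
    rw [MvPolynomial.pderiv_mul]
    rfl
  comm i j := LinearMap.ext fun f => pderiv_comm i j f

/-- The map `F ↦ T̃(λ(F))`, which replaces the commutative products of the `L_i` by their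
symmetrized star-products. -/
def symPoly : N →ₗ[ℝ] Nν :=
  symMap star ∘ₗ (MvPolynomial.aeval fun i => SymmetricAlgebra.ι ℝ N (L i)).toLinearMap

theorem odot_eq (F G : Nν) : odot star F G = symPoly (F.coeff 0 * G.coeff 0) := by
  simp [odot, symPoly, lam0]

theorem symPoly_prod {k : ℕ} (F : Fin k → Fin 3) :
    symPoly (∏ a, L (F a)) =
      symProd (A := Module.End ℝ Nν) star_isStarProduct.leftMul k (fun a => L (F a)) 1 := by
  have h : MvPolynomial.aeval (fun i => SymmetricAlgebra.ι ℝ N (L i)) (∏ a, L (F a)) =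
      ∏ a, SymmetricAlgebra.ι ℝ N (L (F a)) := by
    simp [map_prod, L]
  rw [symPoly, LinearMap.comp_apply, AlgHom.toLinearMap_apply, h,
    star_isStarProduct.symMap_spec k, star_isStarProduct.symProd_leftMul]

theorem prod_eq_mul_prod_swap {k : ℕ} {R : Type} [CommMonoid R] (y : Fin (k + 1) → R)
    (a : Fin (k + 1)) : ∏ b, y b = y a * ∏ b : Fin k, y (Equiv.swap 0 a b.succ) := by
  rw [← Equiv.prod_comp (Equiv.swap 0 a), Fin.prod_univ_succ, Equiv.swap_apply_left]

theorem derivation_finset_prod {ι : Type} [DecidableEq ι] (D : Derivation ℝ N N) (s : Finset ι)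
    (y : ι → N) : D (∏ a ∈ s, y a) = ∑ a ∈ s, D (y a) * ∏ b ∈ s.erase a, y b := by
  induction s using Finset.induction_on with
  | empty => simp
  | insert c s hc ih =>
    have h : ∀ a ∈ s, D (y a) * ∏ b ∈ (insert c s).erase a, y b =
        y c * (D (y a) * ∏ b ∈ s.erase a, y b) := by
      intro a ha
      have hne : a ≠ c := fun h => hc (h ▸ ha)
      rw [Finset.erase_insert_of_ne hne.symm,
        Finset.prod_insert (fun h => hc (Finset.mem_of_mem_erase h))]
      ring
    rw [Finset.prod_insert hc, Finset.sum_insert hc, Finset.erase_insert hc, Derivation.leibniz,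
      ih, Finset.sum_congr rfl h, ← Finset.mul_sum, smul_eq_mul, smul_eq_mul]
    ring

theorem dN_prod {k : ℕ} (F : Fin (k + 1) → Fin 3) (i : Fin 3) :
    dN i (∏ a, L (F a)) =
      ∑ a, if F a = i then ∏ b : Fin k, L (F (Equiv.swap 0 a b.succ)) else 0 := by
  refine (derivation_finset_prod (MvPolynomial.pderiv i) _ _).trans ?_
  refine Finset.sum_congr rfl fun a _ => ?_
  have h : ∏ b ∈ Finset.univ.erase a, L (F b) = ∏ b : Fin k, L (F (Equiv.swap 0 a b.succ)) :=
    mul_left_cancel₀ (MvPolynomial.X_ne_zero (F a))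
      ((Finset.mul_prod_erase _ (fun b => L (F b)) (Finset.mem_univ a)).trans
        (prod_eq_mul_prod_swap (fun b => L (F b)) a))
  rw [h, L, MvPolynomial.pderiv_X, Pi.single_apply]
  simp only [ite_mul, one_mul, zero_mul]

theorem exists_prod_of_monomial (s : Fin 3 →₀ ℕ) (a : ℝ) :
    ∃ (k : ℕ) (F : Fin k → Fin 3), MvPolynomial.monomial s a = a • ∏ j, L (F j) := by
  let l := (Finsupp.toMultiset s).toList
  refine ⟨l.length, l.get, ?_⟩
  have h1 : ∏ j, L (l.get j) = ((Finsupp.toMultiset s).map L).prod := by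
    rw [← List.prod_ofFn]
    change (List.ofFn (L ∘ l.get)).prod = _
    rw [← List.map_ofFn, List.ofFn_get, ← Multiset.prod_coe, ← Multiset.map_coe,
      Multiset.coe_toList]
  rw [h1, Finset.prod_multiset_map_count, MvPolynomial.monomial_eq, MvPolynomial.smul_eq_C_mul]
  simp only [Finsupp.toFinset_toMultiset, Finsupp.count_toMultiset]
  rfl

theorem star_zero_right (F : Nν) : star F 0 = 0 := by
  simpa using star_isStarProduct.smul_right 0 F 0

theorem star_sum_right {ι : Type} (s : Finset ι) (F : Nν) (G : ι → Nν) :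
    star F (∑ a ∈ s, G a) = ∑ a ∈ s, star F (G a) := by
  classical
  induction s using Finset.induction_on with
  | empty => simp [star_zero_right]
  | insert c s hc ih =>
    rw [Finset.sum_insert hc, star_isStarProduct.add_right, ih, Finset.sum_insert hc]

theorem euler_apply (f : N) : euler L dN f = ∑ i, L i * dN i f := by
  simp [euler, LinearMap.sum_apply]

theorem euler_prod {k : ℕ} (F : Fin (k + 1) → Fin 3) :
    euler L dN (∏ a, L (F a)) = (k + 1 : ℝ) • ∏ a, L (F a) := by
  rw [euler_apply]
  simp only [dN_prod, Finset.mul_sum]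
  rw [Finset.sum_comm]
  simp only [mul_ite, mul_zero, Finset.sum_ite_eq, Finset.mem_univ, if_true]
  have h : ∀ a ∈ Finset.univ, L (F a) * ∏ b : Fin k, L (F (Equiv.swap 0 a b.succ)) =
      ∏ a, L (F a) := fun a _ => (prod_eq_mul_prod_swap (fun b => L (F b)) a).symm
  rw [Finset.sum_congr rfl h, Finset.sum_const, Finset.card_univ, Fintype.card_fin,
    ← Nat.cast_smul_eq_nsmul ℝ]
  push_cast
  rfl

/-- Symmetrized star-products can be computed recursively, by splitting off the first factor. -/
theorem symPoly_euler (f : N) :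
    symPoly (euler L dN f) = ∑ i, star (Polynomial.C (L i)) (symPoly (dN i f)) := by
  induction f using MvPolynomial.induction_on' with
  | add f g hf hg =>
    simp only [map_add, hf, hg, star_isStarProduct.add_right, Finset.sum_add_distrib]
  | monomial u a =>
    obtain ⟨k, F, h⟩ := exists_prod_of_monomial u a
    simp only [h, map_smul, star_isStarProduct.smul_right, ← Finset.smul_sum]
    congr 1
    rcases k with _ | k
    · have h1 : ∀ i, dN i (1 : N) = 0 := fun i => MvPolynomial.pderiv_one
      simp [euler_apply, h1, star_zero_right]
    · have h1 : ∀ i, star (Polynomial.C (L i)) (symPoly (dN i (∏ a, L (F a)))) =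
          ∑ a, if F a = i then star (Polynomial.C (L i))
            (symPoly (∏ b : Fin k, L (F (Equiv.swap 0 a b.succ)))) else 0 := by
        intro i
        simp only [dN_prod, map_sum, star_sum_right, apply_ite symPoly,
          apply_ite (star (Polynomial.C (L i))), map_zero, star_zero_right]
      simp only [h1]
      rw [Finset.sum_comm]
      simp only [Finset.sum_ite_eq, Finset.mem_univ, if_true]
      rw [euler_prod, map_smul, symPoly_prod, ← LinearMap.smul_apply, symProd_succ,
        LinearMap.sum_apply]
      refine Finset.sum_congr rfl fun a _ => ?_
      rw [symPoly_prod, Module.End.mul_apply, IsStarProduct.leftMul_apply]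

/-! ### Homogeneous polynomials -/

theorem star_L_monomial (i : Fin 3) (n : ℕ) (f : N) :
    star (Polynomial.C (L i)) (Polynomial.monomial n f) = Polynomial.monomial n (L i * f) +
      Polynomial.monomial (n + 1) (rotation i f) +
      Polynomial.monomial (n + 2) (secondOrder i f) := by
  rw [← Polynomial.C_mul_X_pow_eq_monomial, mul_comm, star_isStarProduct.nu_pow_right, star_L]
  simp only [← Polynomial.C_mul_X_pow_eq_monomial]
  ring

theorem coeff_zero_star_L (i : Fin 3) (G : Nν) :
    (star (Polynomial.C (L i)) G).coeff 0 = L i * G.coeff 0 := by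
  induction G using Polynomial.induction_on' with
  | add F G hF hG => simp only [star_isStarProduct.add_right, Polynomial.coeff_add, hF, hG, mul_add]
  | monomial n f =>
    simp [star_L_monomial, Polynomial.coeff_monomial]

theorem coeff_one_star_L (i : Fin 3) (G : Nν) :
    (star (Polynomial.C (L i)) G).coeff 1 = L i * G.coeff 1 + rotation i (G.coeff 0) := by
  induction G using Polynomial.induction_on' with
  | add F G hF hG =>
    simp only [star_isStarProduct.add_right, Polynomial.coeff_add, hF, hG, map_add]
    ring
  | monomial n f =>
    simp [star_L_monomial, Polynomial.coeff_monomial, apply_ite (rotation i)]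

theorem coeff_add_two_star_L (i : Fin 3) (G : Nν) (k : ℕ) :
    (star (Polynomial.C (L i)) G).coeff (k + 2) =
      L i * G.coeff (k + 2) + rotation i (G.coeff (k + 1)) + secondOrder i (G.coeff k) := by
  induction G using Polynomial.induction_on' with
  | add F G hF hG =>
    simp only [star_isStarProduct.add_right, Polynomial.coeff_add, hF, hG, map_add]
    ring
  | monomial n f =>
    simp [star_L_monomial, Polynomial.coeff_monomial, apply_ite (rotation i),
      apply_ite (secondOrder i)]

/-- The contraction of the antisymmetric tensor with second derivatives vanishes. -/
theorem sum_rotation_dN (f : N) : ∑ i, rotation i (dN i f) = 0 := by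
  have hc : ∀ a b, dN a (dN b f) = dN b (dN a f) := fun a b => pderiv_comm a b f
  simp only [rotation_apply, Fin.sum_univ_three, eps, hc 1 0, hc 2 0, hc 2 1]
  simp
  norm_num
  ring

theorem sum_secondOrder_dN (f : N) :
    ∑ i, secondOrder i (dN i f) =
      (2 : ℝ) • laplacian dN f + euler L dN (laplacian dN f) := by
  have hc : ∀ g a b, dN a (dN b g) = dN b (dN a g) := fun g a b => pderiv_comm a b g
  simp only [secondOrder_apply, euler_apply, laplacian, Fin.sum_univ_three, LinearMap.add_apply,
    pow_two, Module.End.mul_apply, map_add, hc _ 1 0, hc _ 2 0, hc _ 2 1, two_smul]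
  ring

theorem euler_of_isHomogeneous {n : ℕ} {f : N} (hf : f.IsHomogeneous n) :
    euler L dN f = (n : ℝ) • f := by
  rw [Nat.cast_smul_eq_nsmul, ← hf.sum_X_mul_pderiv, euler_apply]
  rfl

theorem dN_eq_zero {f : N} (hf : f.IsHomogeneous 0) (i : Fin 3) : dN i f = 0 := by
  rw [← MvPolynomial.totalDegree_zero_iff_isHomogeneous,
    MvPolynomial.totalDegree_eq_zero_iff_eq_C] at hf
  rw [hf]
  exact MvPolynomial.pderiv_C

theorem isHomogeneous_laplacian {n : ℕ} {f : N} (hf : f.IsHomogeneous n) :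
    (laplacian dN f).IsHomogeneous (n - 2) := by
  simp only [laplacian, LinearMap.sum_apply, pow_two]
  exact MvPolynomial.IsHomogeneous.sum _ _ _ fun i _ => (hf.pderiv (i := i)).pderiv (i := i)

theorem laplacian_eq_zero {n : ℕ} {f : N} (hf : f.IsHomogeneous n) (hn : n < 2) :
    laplacian dN f = 0 := by
  simp only [laplacian, LinearMap.sum_apply, pow_two]
  refine Finset.sum_eq_zero fun i _ => dN_eq_zero ?_ i
  have h : (dN i f).IsHomogeneous (n - 1) := hf.pderiv
  rwa [show n - 1 = 0 by omega] at h

theorem isHomogeneous_laplacian_pow {n : ℕ} {f : N} (hf : f.IsHomogeneous n) (r : ℕ) :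
    ((laplacian dN ^ r) f).IsHomogeneous (n - 2 * r) := by
  induction r with
  | zero => simpa using hf
  | succ r ih =>
    rw [pow_succ', Module.End.mul_apply, show n - 2 * (r + 1) = n - 2 * r - 2 by omega]
    exact isHomogeneous_laplacian ih

theorem laplacian_pow_eq_zero {n r : ℕ} {f : N} (hf : f.IsHomogeneous n) (hn : n < 2 * r) :
    (laplacian dN ^ r) f = 0 := by
  induction r generalizing n f with
  | zero => omega
  | succ r ih =>
    rw [pow_succ, Module.End.mul_apply]
    rcases Nat.lt_or_ge n 2 with h | h
    · rw [laplacian_eq_zero hf h, map_zero]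
    · exact ih (isHomogeneous_laplacian hf) (by omega)

theorem laplacian_pow_dN (r : ℕ) (i : Fin 3) (f : N) :
    (laplacian dN ^ r) (dN i f) = dN i ((laplacian dN ^ r) f) := by
  have h : Commute (laplacian dN) (dN i) :=
    Commute.sum_left _ _ _ fun j _ => (isPartials_dN.comm j i).pow_left 2
  exact congrArg (fun S => S f) (h.pow_left r).eq

theorem euler_laplacian_pow {n : ℕ} {f : N} (hf : f.IsHomogeneous n) (r : ℕ) :
    euler L dN ((laplacian dN ^ r) f) = (n - 2 * r : ℝ) • (laplacian dN ^ r) f := by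
  rcases Nat.lt_or_ge n (2 * r) with h | h
  · rw [laplacian_pow_eq_zero hf h, map_zero, smul_zero]
  · rw [euler_of_isHomogeneous (isHomogeneous_laplacian_pow hf r)]
    push_cast [h]
    rfl

theorem eta_of_isHomogeneous {n : ℕ} {f : N} (hf : f.IsHomogeneous n) (r : ℕ) :
    eta L dN r f = etaScalar r (n - 2 * r) • (laplacian dN ^ r) f := by
  have haeval : ∀ q : Polynomial ℝ, Polynomial.aeval (euler L dN) q ((laplacian dN ^ r) f) =
      q.eval (n - 2 * r : ℝ) • (laplacian dN ^ r) f := by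
    intro q
    by_cases h : (laplacian dN ^ r) f = 0
    · rw [h, map_zero, smul_zero]
    · exact Module.End.aeval_apply_of_hasEigenvector
        ⟨Module.End.mem_eigenspace_iff.2 (euler_laplacian_pow hf r), h⟩
  simp only [eta, etaScalar, Module.End.mul_apply, LinearMap.add_apply, LinearMap.sum_apply,
    LinearMap.smul_apply, haeval, Module.End.one_apply, add_smul, Finset.sum_smul, smul_smul]

/-- The recursion for symmetrized products and the recursion for the scalars match. -/
theorem etaScalar_laplacian_rec {n : ℕ} {f : N} (hf : f.IsHomogeneous (n + 1)) (r : ℕ) :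
    (n + 1 : ℝ) • eta L dN (r + 1) f =
      ∑ i, (L i * eta L dN (r + 1) (dN i f) + secondOrder i (eta L dN r (dN i f))) := by
  have hd : ∀ i, (dN i f).IsHomogeneous n := fun i => hf.pderiv
  simp only [eta_of_isHomogeneous (hd _), eta_of_isHomogeneous hf, Finset.sum_add_distrib,
    laplacian_pow_dN, map_smul, mul_smul_comm, ← Finset.smul_sum]
  rw [sum_secondOrder_dN, ← euler_apply, ← Module.End.mul_apply (laplacian dN), ← pow_succ',
    euler_laplacian_pow hf, smul_smul]
  rcases Nat.lt_or_ge (n + 1) (2 * (r + 1)) with h | h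
  · simp [laplacian_pow_eq_zero hf h]
  · obtain ⟨m, hm⟩ := Nat.exists_eq_add_of_le h
    have hm' : (n : ℝ) = m + 2 * r + 1 := by
      have : ((n + 1 : ℕ) : ℝ) = ((2 * (r + 1) + m : ℕ) : ℝ) := by rw [hm]
      push_cast at this
      linarith
    have hrec := etaScalar_rec r m
    push_cast
    rw [show ((n : ℝ) + 1 - 2 * (r + 1)) = m by rw [hm']; ring,
      show ((n : ℝ) - 2 * (r + 1)) = m - 1 by rw [hm']; ring,
      show ((n : ℝ) - 2 * r) = m + 1 by rw [hm']; ring, smul_smul, ← add_smul, smul_smul,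
      ← add_smul, show ((n : ℝ) + 1) = m + 2 * (r + 1) by rw [hm']; ring, hrec]
    congr 1
    ring

theorem eta_zero {A : Type} [CommRing A] [Algebra ℝ A] (x : Fin 3 → A)
    (d : Fin 3 → Module.End ℝ A) : eta x d 0 = 1 := by
  simp [eta, Acoef_zero]

theorem coeff_symPoly_of_isHomogeneous {n : ℕ} {f : N} (hf : f.IsHomogeneous n) (r : ℕ) :
    (symPoly f).coeff (2 * r) = eta L dN r f ∧ (symPoly f).coeff (2 * r + 1) = 0 := by
  induction n generalizing f r with
  | zero =>
    have hf' := hf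
    rw [← MvPolynomial.totalDegree_zero_iff_isHomogeneous,
      MvPolynomial.totalDegree_eq_zero_iff_eq_C] at hf'
    have hsym : symPoly f = Polynomial.C f := by
      have h1 : symPoly 1 = 1 := by
        have h := symPoly_prod (k := 0) Fin.elim0
        rw [symProd_apply] at h
        simpa using h
      rw [hf', ← mul_one (MvPolynomial.C _), ← MvPolynomial.smul_eq_C_mul, map_smul, h1,
        ← Polynomial.smul_C, Polynomial.C_1]
    rw [hsym]
    rcases r with _ | r
    · simp [eta_zero, Polynomial.coeff_C_succ]
    · rw [eta_of_isHomogeneous hf, laplacian_pow_eq_zero hf (by omega), smul_zero,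
        Polynomial.coeff_C_of_ne_zero (by omega), Polynomial.coeff_C_of_ne_zero (by omega)]
      exact ⟨rfl, rfl⟩
  | succ n ih =>
    have hd : ∀ i, (dN i f).IsHomogeneous n := fun i => hf.pderiv
    have heul : (n + 1 : ℝ) • symPoly f =
        ∑ i, star (Polynomial.C (L i)) (symPoly (dN i f)) := by
      rw [← symPoly_euler, euler_of_isHomogeneous hf, map_smul]
      push_cast
      rfl
    have hn : (n + 1 : ℝ) ≠ 0 := by positivity
    have hrot : ∀ r, ∑ i, rotation i (eta L dN r (dN i f)) = 0 := by
      intro r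
      simp only [eta_of_isHomogeneous (hd _), laplacian_pow_dN, map_smul, ← Finset.smul_sum,
        sum_rotation_dN, smul_zero]
    have hcoeff : ∀ k, (n + 1 : ℝ) • (symPoly f).coeff k =
        ∑ i, (star (Polynomial.C (L i)) (symPoly (dN i f))).coeff k := by
      intro k
      rw [← Polynomial.coeff_smul, heul, Polynomial.finsetSum_coeff]
    constructor
    · refine smul_right_injective _ hn ?_
      simp only [hcoeff]
      rcases r with _ | r
      · simp only [mul_zero, coeff_zero_star_L]
        have h0 : ∀ i, (symPoly (dN i f)).coeff 0 = dN i f := fun i => by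
          simpa [eta_zero] using (ih (hd i) 0).1
        simp only [h0, eta_zero, Module.End.one_apply]
        rw [← euler_apply, euler_of_isHomogeneous hf]
        push_cast
        rfl
      · rw [etaScalar_laplacian_rec hf, show 2 * (r + 1) = 2 * r + 2 by ring]
        refine Finset.sum_congr rfl fun i _ => ?_
        rw [coeff_add_two_star_L, (ih (hd i) r).1, (ih (hd i) r).2, ← (ih (hd i) (r + 1)).1,
          map_zero, add_zero]
        rfl
    · refine smul_right_injective _ hn ?_
      simp only [hcoeff, smul_zero]
      rcases r with _ | r
      · simp only [mul_zero, zero_add, coeff_one_star_L]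
        have h0 : ∀ i, (symPoly (dN i f)).coeff 0 = eta L dN 0 (dN i f) := fun i =>
          (ih (hd i) 0).1
        have h1 : ∀ i, (symPoly (dN i f)).coeff 1 = 0 := fun i => (ih (hd i) 0).2
        simp only [h0, h1, mul_zero, zero_add, hrot]
      · rw [show 2 * (r + 1) + 1 = (2 * r + 1) + 2 by ring]
        simp only [coeff_add_two_star_L]
        have h0 : ∀ i, (symPoly (dN i f)).coeff (2 * r + 1 + 1) = eta L dN (r + 1) (dN i f) :=
          fun i => (ih (hd i) (r + 1)).1
        have h1 : ∀ i, (symPoly (dN i f)).coeff (2 * r + 1 + 2) = 0 :=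
          fun i => (ih (hd i) (r + 1)).2
        have h2 : ∀ i, (symPoly (dN i f)).coeff (2 * r + 1) = 0 := fun i => (ih (hd i) r).2
        simp only [h0, h1, h2, mul_zero, map_zero, zero_add, add_zero, hrot]

/-- The formula for the `⊙`-product: `T̃(λ(f)) = ∑ ν^{2r} η_r(f)`. -/
theorem coeff_symPoly (f : N) (r : ℕ) :
    (symPoly f).coeff (2 * r) = eta L dN r f ∧ (symPoly f).coeff (2 * r + 1) = 0 := by
  have h : ∀ k, (symPoly f).coeff k = ∑ i ∈ Finset.range (f.totalDegree + 1),
      (symPoly (MvPolynomial.homogeneousComponent i f)).coeff k := by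
    intro k
    rw [← Polynomial.finsetSum_coeff, ← map_sum, MvPolynomial.sum_homogeneousComponent]
  have hc := fun i => coeff_symPoly_of_isHomogeneous
    (MvPolynomial.homogeneousComponent_isHomogeneous i f) r
  constructor
  · rw [h, Finset.sum_congr rfl fun i _ => (hc i).1, ← map_sum,
      MvPolynomial.sum_homogeneousComponent]
  · rw [h, Finset.sum_congr rfl fun i _ => (hc i).2, Finset.sum_const_zero]

/-! ### Smooth functions -/

theorem dS_apply (i : Fin 3) (f : Smooth) (x : Fin 3 → ℝ) :
    (dS i f).1 x = fderiv ℝ f.1 x (Pi.single i 1) := rfl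

theorem dS_dS_apply (i j : Fin 3) (f : Smooth) (x : Fin 3 → ℝ) :
    (dS i (dS j f)).1 x = fderiv ℝ (fderiv ℝ f.1) x (Pi.single i 1) (Pi.single j 1) := by
  have hd : DifferentiableAt ℝ (fderiv ℝ f.1) x :=
    ((contDiff_smooth f).fderiv_right (m := ∞) le_rfl).differentiable (by simp) x
  have h := fderiv_clm_apply hd (differentiableAt_const (Pi.single j (1 : ℝ)))
  change fderiv ℝ (fun y => fderiv ℝ f.1 y (Pi.single j 1)) x (Pi.single i 1) = _
  rw [h]
  simp

theorem isPartials_dS : IsPartials dS where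
  leibniz i f g := by
    ext x
    change fderiv ℝ (f.1 * g.1) x (Pi.single i 1) =
      fderiv ℝ f.1 x (Pi.single i 1) * g.1 x + f.1 x * fderiv ℝ g.1 x (Pi.single i 1)
    rw [fderiv_mul (differentiable_smooth f x) (differentiable_smooth g x)]
    simp
    ring
  comm i j := by
    refine LinearMap.ext fun f => Subtype.ext (funext fun x => ?_)
    have h : IsSymmSndFDerivAt ℝ f.1 x :=
      (contDiff_smooth f).contDiffAt.isSymmSndFDerivAt (by
        rw [minSmoothness_of_isRCLikeNormedField]
        exact WithTop.coe_le_coe.2 (le_top : (2 : ℕ∞) ≤ ⊤))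
    rw [Module.End.mul_apply, Module.End.mul_apply, dS_dS_apply, dS_dS_apply, h]

theorem toSmooth_L (i : Fin 3) : toSmooth (L i) = coordS i := MvPolynomial.aeval_X _ _

theorem toSmooth_apply (F : N) (x : Fin 3 → ℝ) : (toSmooth F).1 x = MvPolynomial.eval x F := by
  induction F using MvPolynomial.induction_on with
  | C a =>
    rw [toSmooth, MvPolynomial.aeval_C, MvPolynomial.eval_C]
    rfl
  | add F G hF hG =>
    rw [map_add, map_add, ← hF, ← hG]
    rfl
  | mul_X F i hF =>
    rw [map_mul, map_mul, ← hF, MvPolynomial.eval_X]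
    change _ * (toSmooth (L i)).1 x = _
    rw [toSmooth_L]
    rfl

theorem dS_coordS (i j : Fin 3) : dS i (coordS j) = if i = j then 1 else 0 := by
  ext x
  rw [dS_apply]
  have h : fderiv ℝ (coordS j).1 x = ContinuousLinearMap.proj (R := ℝ) (φ := fun _ => ℝ) j :=
    (ContinuousLinearMap.proj (R := ℝ) (φ := fun _ : Fin 3 => ℝ) j).hasFDerivAt.fderiv
  rw [h, ContinuousLinearMap.proj_apply]
  by_cases hij : i = j
  · subst hij
    rw [Pi.single_eq_same, if_pos rfl]
    rfl
  · rw [Pi.single_eq_of_ne (Ne.symm hij), if_neg hij]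
    rfl

theorem toSmooth_dN (i : Fin 3) (F : N) : toSmooth (dN i F) = dS i (toSmooth F) := by
  induction F using MvPolynomial.induction_on with
  | C a =>
    have h : dN i (MvPolynomial.C a) = 0 := MvPolynomial.pderiv_C
    rw [h, map_zero, toSmooth, MvPolynomial.aeval_C]
    ext x
    rw [dS_apply]
    change 0 = fderiv ℝ (fun _ => a) x _
    simp
  | add F G hF hG => simp only [map_add, hF, hG]
  | mul_X F j hF =>
    have h : dN i (MvPolynomial.X j) = if i = j then 1 else 0 := by
      change MvPolynomial.pderiv i (MvPolynomial.X j) = _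
      rw [MvPolynomial.pderiv_X, Pi.single_apply]
      simp only [eq_comm]
    have h' : toSmooth (MvPolynomial.X j) = coordS j := toSmooth_L j
    rw [isPartials_dN.leibniz, map_add, map_mul, map_mul, map_mul, isPartials_dS.leibniz, hF, h,
      h', dS_coordS]
    simp only [apply_ite toSmooth, map_one, map_zero]

/-! ### Polynomials with prescribed derivatives at a point -/

theorem dN_X_sub_C (i j : Fin 3) (a : ℝ) :
    dN i (MvPolynomial.X j - MvPolynomial.C a) = if j = i then 1 else 0 := by
  change MvPolynomial.pderiv i (MvPolynomial.X j - MvPolynomial.C a) = _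
  rw [map_sub, MvPolynomial.pderiv_C, sub_zero, MvPolynomial.pderiv_X, Pi.single_apply]

theorem dN_pow_mul (i : Fin 3) (u w : N) (hw : dN i w = 0) (hu : dN i u = 1) (a b : ℕ) :
    (dN i ^ a) (u ^ b * w) = (b.descFactorial a : ℝ) • (u ^ (b - a) * w) := by
  have hpow : ∀ b : ℕ, dN i (u ^ b) = (b : ℝ) • u ^ (b - 1) := by
    intro b
    refine (Derivation.leibniz_pow (MvPolynomial.pderiv i) u b).trans ?_
    change b • u ^ (b - 1) • dN i u = _
    rw [hu, smul_eq_mul, mul_one, Nat.cast_smul_eq_nsmul]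
  induction a with
  | zero => simp
  | succ a ih =>
    rw [pow_succ', Module.End.mul_apply, ih, map_smul, isPartials_dN.leibniz, hpow, hw, mul_zero,
      add_zero, Nat.descFactorial_succ, smul_mul_assoc, smul_smul, Nat.sub_sub, Nat.cast_mul,
      mul_comm (b.descFactorial a : ℝ)]

theorem dN_pow_eq_zero (i : Fin 3) (u : N) (hu : dN i u = 0) (b : ℕ) : dN i (u ^ b) = 0 := by
  refine (Derivation.leibniz_pow (MvPolynomial.pderiv i) u b).trans ?_
  change b • u ^ (b - 1) • dN i u = _
  rw [hu, smul_zero, smul_zero]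

/-- The monomials centred at `x` are dual to the partial derivatives at `x`. -/
theorem eval_multiDeriv_centred (x : Fin 3 → ℝ) (α β : Fin 3 → ℕ) :
    MvPolynomial.eval x (multiDeriv dN α ((MvPolynomial.X 0 - MvPolynomial.C (x 0)) ^ β 0 *
      ((MvPolynomial.X 1 - MvPolynomial.C (x 1)) ^ β 1 *
        (MvPolynomial.X 2 - MvPolynomial.C (x 2)) ^ β 2))) =
      if α = β then ((β 0).factorial * (β 1).factorial * (β 2).factorial : ℝ) else 0 := by
  set u : Fin 3 → N := fun i => MvPolynomial.X i - MvPolynomial.C (x i) with hu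
  have h1 : ∀ i, dN i (u i) = 1 := fun i => by simp [hu, dN_X_sub_C]
  have h0 : ∀ i j b, i ≠ j → dN i (u j ^ b) = 0 := fun i j b hij =>
    dN_pow_eq_zero _ _ (by simp [hu, dN_X_sub_C, hij.symm]) _
  have hmul : ∀ i (f g : N), dN i f = 0 → dN i g = 0 → dN i (f * g) = 0 := fun i f g hf hg => by
    rw [isPartials_dN.leibniz, hf, hg, zero_mul, mul_zero, add_zero]
  have hev : ∀ i, MvPolynomial.eval x (u i) = 0 := fun i => by simp [hu]
  have hM : multiDeriv dN α (u 0 ^ β 0 * (u 1 ^ β 1 * u 2 ^ β 2)) =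
      ((β 0).descFactorial (α 0) * (β 1).descFactorial (α 1) * (β 2).descFactorial (α 2) : ℝ) •
        (u 0 ^ (β 0 - α 0) * (u 1 ^ (β 1 - α 1) * u 2 ^ (β 2 - α 2))) := by
    have e2 : u 0 ^ β 0 * (u 1 ^ β 1 * u 2 ^ β 2) = u 2 ^ β 2 * (u 0 ^ β 0 * u 1 ^ β 1) := by ring
    have e1 : u 2 ^ (β 2 - α 2) * (u 0 ^ β 0 * u 1 ^ β 1) =
        u 1 ^ β 1 * (u 0 ^ β 0 * u 2 ^ (β 2 - α 2)) := by ring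
    have e0 : u 1 ^ (β 1 - α 1) * (u 0 ^ β 0 * u 2 ^ (β 2 - α 2)) =
        u 0 ^ β 0 * (u 1 ^ (β 1 - α 1) * u 2 ^ (β 2 - α 2)) := by ring
    rw [multiDeriv, Module.End.mul_apply, Module.End.mul_apply, e2,
      dN_pow_mul 2 (u 2) _ (hmul _ _ _ (h0 _ _ _ (by decide)) (h0 _ _ _ (by decide))) (h1 2),
      map_smul, e1,
      dN_pow_mul 1 (u 1) _ (hmul _ _ _ (h0 _ _ _ (by decide)) (h0 _ _ _ (by decide))) (h1 1),
      map_smul, map_smul, e0,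
      dN_pow_mul 0 (u 0) _ (hmul _ _ _ (h0 _ _ _ (by decide)) (h0 _ _ _ (by decide))) (h1 0),
      smul_smul, smul_smul]
    congr 1
    ring
  change MvPolynomial.eval x (multiDeriv dN α (u 0 ^ β 0 * (u 1 ^ β 1 * u 2 ^ β 2))) = _
  rw [hM, MvPolynomial.smul_eval, map_mul, map_mul, map_pow, map_pow, map_pow, hev, hev, hev]
  have key : ∀ a b : ℕ, (b.descFactorial a : ℝ) * 0 ^ (b - a) =
      if a = b then (b.factorial : ℝ) else 0 := by
    intro a b
    rcases lt_trichotomy a b with h | rfl | h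
    · rw [zero_pow (by omega), mul_zero, if_neg h.ne]
    · rw [if_pos rfl, Nat.sub_self, pow_zero, mul_one, Nat.descFactorial_self]
    · rw [Nat.descFactorial_of_lt h, if_neg h.ne', Nat.cast_zero, zero_mul]
  trans ((β 0).descFactorial (α 0) * 0 ^ (β 0 - α 0) : ℝ) *
    ((β 1).descFactorial (α 1) * 0 ^ (β 1 - α 1)) * ((β 2).descFactorial (α 2) * 0 ^ (β 2 - α 2))
  · ring
  rw [key, key, key]
  by_cases h : α = β
  · simp [h]
  · have h' : ¬(α 0 = β 0 ∧ α 1 = β 1 ∧ α 2 = β 2) := fun h' =>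
      h (funext fun i => by fin_cases i; exacts [h'.1, h'.2.1, h'.2.2])
    rw [if_neg h]
    by_cases h2 : α 0 = β 0
    · by_cases h3 : α 1 = β 1
      · rw [if_neg (fun h4 => h' ⟨h2, h3, h4⟩), mul_zero]
      · rw [if_neg h3, mul_zero, zero_mul]
    · rw [if_neg h2, zero_mul, zero_mul]

/-- Taylor polynomials: finitely many derivatives at a point can be prescribed. -/
theorem exists_polynomial_multiDeriv (x : Fin 3 → ℝ) (t : Finset (Fin 3 → ℕ))
    (v : (Fin 3 → ℕ) → ℝ) :
    ∃ F : N, ∀ α ∈ t, (multiDeriv dS α (toSmooth F)).1 x = v α := by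
  classical
  refine ⟨∑ β ∈ t, (v β / ((β 0).factorial * (β 1).factorial * (β 2).factorial)) •
    ((MvPolynomial.X 0 - MvPolynomial.C (x 0)) ^ β 0 *
      ((MvPolynomial.X 1 - MvPolynomial.C (x 1)) ^ β 1 *
        (MvPolynomial.X 2 - MvPolynomial.C (x 2)) ^ β 2)), fun α hα => ?_⟩
  rw [← map_multiDeriv toSmooth toSmooth_dN, toSmooth_apply]
  simp only [map_sum, map_smul, MvPolynomial.smul_eval, eval_multiDeriv_centred, mul_ite, mul_zero]
  rw [Finset.sum_ite_eq, if_pos hα]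
  have : ((α 0).factorial * (α 1).factorial * (α 2).factorial : ℝ) ≠ 0 := by positivity
  field_simp

/-- Two bidifferential operators with smooth coefficients that agree on polynomials are equal. -/
theorem bidiffOp_ext {B B' : Smooth → Smooth → Smooth} (hB : IsBidiffOp dS B)
    (hB' : IsBidiffOp dS B')
    (h : ∀ F G : N, B (toSmooth F) (toSmooth G) = B' (toSmooth F) (toSmooth G)) : B = B' := by
  classical
  obtain ⟨s, c, hs⟩ := hB
  obtain ⟨s', c', hs'⟩ := hB'
  funext f g
  refine Subtype.ext (funext fun x => ?_)
  obtain ⟨F, hF⟩ := exists_polynomial_multiDeriv x ((s ∪ s').image Prod.fst)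
    fun α => (multiDeriv dS α f).1 x
  obtain ⟨G, hG⟩ := exists_polynomial_multiDeriv x ((s ∪ s').image Prod.snd)
    fun α => (multiDeriv dS α g).1 x
  have hval : ∀ (c : (Fin 3 → ℕ) × (Fin 3 → ℕ) → Smooth) (s : Finset _) (f g : Smooth),
      (∑ ab ∈ s, c ab * multiDeriv dS ab.1 f * multiDeriv dS ab.2 g).1 x =
        ∑ ab ∈ s, (c ab).1 x * (multiDeriv dS ab.1 f).1 x * (multiDeriv dS ab.2 g).1 x := by
    intro c s f g
    rw [AddSubmonoidClass.coe_finsetSum, Finset.sum_apply]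
    rfl
  have hmem : ∀ ab ∈ s ∪ s', (multiDeriv dS ab.1 (toSmooth F)).1 x = (multiDeriv dS ab.1 f).1 x ∧
      (multiDeriv dS ab.2 (toSmooth G)).1 x = (multiDeriv dS ab.2 g).1 x := fun ab hab =>
    ⟨hF _ (Finset.mem_image_of_mem _ hab), hG _ (Finset.mem_image_of_mem _ hab)⟩
  have h1 : (B f g).1 x = (B (toSmooth F) (toSmooth G)).1 x := by
    rw [hs, hs, hval, hval]
    refine Finset.sum_congr rfl fun ab hab => ?_
    obtain ⟨h1, h2⟩ := hmem ab (Finset.mem_union_left _ hab)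
    rw [h1, h2]
  have h2 : (B' f g).1 x = (B' (toSmooth F) (toSmooth G)).1 x := by
    rw [hs', hs', hval, hval]
    refine Finset.sum_congr rfl fun ab hab => ?_
    obtain ⟨h1, h2⟩ := hmem ab (Finset.mem_union_right _ hab)
    rw [h1, h2]
  rw [h1, h2, h]

/-! ### The `⊙`-product on smooth functions -/

/-- The extension of the `⊙`-product to smooth functions,
`(f, g) ↦ ∑ ν^{2r} η_r(f g)`. -/
def smoothOdot (f g : Smooth) : PowerSeries Smooth :=
  PowerSeries.mk fun k => if Even k then eta coordS dS (k / 2) (f * g) else 0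

theorem coeff_even_smoothOdot (f g : Smooth) (r : ℕ) :
    PowerSeries.coeff (2 * r) (smoothOdot f g) = eta coordS dS r (f * g) := by
  simp [smoothOdot]

theorem coeff_odd_smoothOdot (f g : Smooth) (r : ℕ) :
    PowerSeries.coeff (2 * r + 1) (smoothOdot f g) = 0 := by
  simp [smoothOdot]

theorem coeff_odot (F G : N) (r : ℕ) :
    (odot star (Polynomial.C F) (Polynomial.C G)).coeff (2 * r) = eta L dN r (F * G) ∧
      (odot star (Polynomial.C F) (Polynomial.C G)).coeff (2 * r + 1) = 0 := by
  rw [odot_eq, Polynomial.coeff_C_zero, Polynomial.coeff_C_zero]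
  exact coeff_symPoly (F * G) r

theorem coeff_embed (F : Nν) (k : ℕ) : PowerSeries.coeff k (embed F) = toSmooth (F.coeff k) := by
  rw [embed, PowerSeries.coeff_map, Polynomial.coeff_coe]
  rfl

theorem toSmooth_eta (r : ℕ) (F : N) :
    toSmooth (eta L dN r F) = eta coordS dS r (toSmooth F) := by
  rw [map_eta toSmooth toSmooth_dN]
  simp only [toSmooth_L]

theorem smoothOdot_toSmooth (F G : N) :
    smoothOdot (toSmooth F) (toSmooth G) =
      embed (odot star (Polynomial.C F) (Polynomial.C G)) := by
  ext1 k
  rw [coeff_embed]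
  rcases Nat.even_or_odd' k with ⟨r, rfl | rfl⟩
  · rw [coeff_even_smoothOdot, (coeff_odot F G r).1, toSmooth_eta, map_mul toSmooth]
  · rw [coeff_odd_smoothOdot, (coeff_odot F G r).2, map_zero]

theorem isSmoothExtension_smoothOdot : IsSmoothExtension (odot star) smoothOdot := by
  refine ⟨fun k => isBidiffOp_of_mem ?_, smoothOdot_toSmooth⟩
  rcases Nat.even_or_odd' k with ⟨r, rfl | rfl⟩
  · simp only [coeff_even_smoothOdot]
    exact isPartials_dS.comp_mul_mem_bidiffOps (isPartials_dS.eta_mem coordS r)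
  · simp only [coeff_odd_smoothOdot]
    exact (bidiffOps dS).zero_mem

theorem eq_smoothOdot {B : Smooth → Smooth → PowerSeries Smooth}
    (hB : IsSmoothExtension (odot star) B) : B = smoothOdot := by
  funext f g
  ext1 k
  refine congrFun (congrFun (bidiffOp_ext (hB.1 k) (isSmoothExtension_smoothOdot.1 k) ?_) f) g
  intro F G
  rw [hB.2, smoothOdot_toSmooth]

theorem coeff_zero_smoothOdot (f g : Smooth) :
    PowerSeries.coeff 0 (smoothOdot f g) = f * g := by
  simpa [eta_zero] using coeff_even_smoothOdot f g 0

/-! ### Triviality and non-triviality -/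

theorem coeff_applySeries_C (S : ℕ → Module.End ℝ N) (F : N) (t : ℕ) :
    PowerSeries.coeff t (applySeries S (PowerSeries.C F)) = S t F := by
  rw [applySeries, PowerSeries.coeff_mk, Finset.sum_eq_single (t, 0)]
  · simp
  · rintro ⟨r, s⟩ h hne
    have hs : s ≠ 0 := by
      rintro rfl
      rw [Finset.HasAntidiagonal.mem_antidiagonal] at h
      exact hne (by simpa using h)
    rw [PowerSeries.coeff_C, if_neg hs, map_zero]
  · intro h
    exact absurd (Finset.HasAntidiagonal.mem_antidiagonal.2 (add_zero t)) h

theorem etaScalar_one_zero : etaScalar 1 0 = 1 := by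
  have h := etaScalar_rec 0 0
  rw [etaScalar_zero] at h
  push_cast at h
  simp only [zero_add, zero_mul, mul_one] at h
  linarith

theorem eta_one_sq : eta L dN 1 (L 0 ^ 2) = 2 := by
  have hhom : (L 0 ^ 2).IsHomogeneous 2 := by
    simpa [L] using (MvPolynomial.isHomogeneous_X ℝ (0 : Fin 3)).pow 2
  have hd : ∀ i, dN i (L 0 ^ 2) = if i = 0 then 2 * L 0 else 0 := by
    intro i
    have h : dN i (L 0) = if i = 0 then 1 else 0 := by
      change MvPolynomial.pderiv i (MvPolynomial.X 0) = _
      rw [MvPolynomial.pderiv_X, Pi.single_apply]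
      simp only [eq_comm]
    rw [pow_two, isPartials_dN.leibniz, h]
    split_ifs <;> ring
  have hd' : dN 0 (2 * L 0) = 2 := by
    change MvPolynomial.pderiv 0 (2 * MvPolynomial.X 0) = _
    rw [← map_ofNat MvPolynomial.C, MvPolynomial.pderiv_C_mul, MvPolynomial.pderiv_X_self, mul_one]
  rw [eta_of_isHomogeneous hhom]
  have : ((2 : ℕ) : ℝ) - 2 * ((1 : ℕ) : ℝ) = 0 := by norm_num
  rw [this, etaScalar_one_zero, one_smul, pow_one, laplacian, Fin.sum_univ_three]
  simp only [LinearMap.add_apply, pow_two (dN _), Module.End.mul_apply, hd]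
  simp [hd']

/-- If `S_ν` were multiplicative from `⊙` to the commutative product, then evaluating at `F = 1`
would give `η_1 = 0`. -/
theorem not_stronglyTrivial : ¬ StronglyTrivial (odot star) := by
  rintro ⟨S, ⟨hS0, -⟩, hS⟩
  have h1 : ∀ F G, S 1 (F * G) = F * S 1 G + S 1 F * G := by
    intro F G
    have h := congrArg (PowerSeries.coeff 1) (hS F G)
    rw [PowerSeries.coeff_mul] at h
    simp only [applySeries, PowerSeries.coeff_mk, Polynomial.coeff_coe,
      Finset.Nat.sum_antidiagonal_eq_sum_range_succ_mk, Finset.sum_range_succ,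
      Finset.sum_range_zero, hS0, Module.End.one_apply] at h
    have hc0 := (coeff_odot F G 0).1
    have hc1 := (coeff_odot F G 0).2
    rw [eta_zero, mul_zero] at hc0
    rw [mul_zero, zero_add] at hc1
    simpa [hc0, hc1] using h
  have h2 : ∀ F G, eta L dN 1 (F * G) + S 2 (F * G) = F * S 2 G + S 1 F * S 1 G + S 2 F * G := by
    intro F G
    have h := congrArg (PowerSeries.coeff 2) (hS F G)
    rw [PowerSeries.coeff_mul] at h
    simp only [applySeries, PowerSeries.coeff_mk, Polynomial.coeff_coe,
      Finset.Nat.sum_antidiagonal_eq_sum_range_succ_mk, Finset.sum_range_succ,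
      Finset.sum_range_zero, hS0, Module.End.one_apply] at h
    have hc0 := (coeff_odot F G 0).1
    have hc1 := (coeff_odot F G 0).2
    have hc2 := (coeff_odot F G 1).1
    rw [eta_zero, mul_zero] at hc0
    rw [mul_zero, zero_add] at hc1
    rw [mul_one] at hc2
    simpa [hc0, hc1, hc2] using h
  have hS1 : S 1 1 = 0 := by simpa using h1 1 1
  -- `F = G = 1` gives `S_1(1) = S_2(1) = 0`; then `F = 1`, `G = L₁²` gives `η_1(L₁²) = 0`
  have heta : eta L dN 1 1 = 0 := by
    rw [eta_of_isHomogeneous (MvPolynomial.isHomogeneous_one _ _),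
      laplacian_pow_eq_zero (MvPolynomial.isHomogeneous_one _ _) (by norm_num), smul_zero]
  have hS2 : S 2 1 = 0 := by simpa [hS1, heta] using h2 1 1
  have h := h2 1 (L 0 ^ 2)
  rw [hS1, hS2, one_mul, one_mul, zero_mul, zero_mul, add_zero, add_zero, eta_one_sq] at h
  simp at h

theorem weaklyTrivial : WeaklyTrivial (odot star) := by
  refine ⟨fun k => if Even k then eta L dN (k / 2) else 0, ⟨by simp [eta_zero], ?_⟩, ?_⟩
  · intro k _
    refine isDiffOp_of_mem ?_
    by_cases h : Even k
    · simp only [if_pos h]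
      exact isPartials_dN.eta_mem L _
    · simp only [if_neg h]
      exact (diffOps dN).zero_mem
  · intro F G
    ext1 k
    rw [coeff_applySeries_C, Polynomial.coeff_coe]
    rcases Nat.even_or_odd' k with ⟨r, rfl | rfl⟩
    · rw [(coeff_odot F G r).1]
      simp
    · rw [(coeff_odot F G r).2]
      simp

end Su2

end

theorem theorem2 :
    -- the star-product on `su(2)*`: it is the restriction of the Moyal product, it is invariant,
    -- and it is the only star-product that satisfies the formula for `L_i ∗ F`
    (∀ F G : Su2.Nν, Su2.pull (Su2.star F G) = Su2.moyal (Su2.pull F) (Su2.pull G)) ∧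
    (∀ m : Su2.Nν → Su2.Nν → Su2.Nν,
      (Su2.IsStarProduct m ∧ Su2.HasLProduct m) ↔ m = Su2.star) ∧
    Su2.IsInvariant Su2.star ∧
    (∃! T, Su2.IsSymmetrization Su2.star T) ∧
    -- the form of the `⊙`-product
    (∀ r : ℕ, 1 ≤ r → Su2.IsDiffOp Su2.dN (Su2.eta Su2.L Su2.dN r)) ∧
    (∀ F G : Su2.N,
      (Su2.odot Su2.star (Polynomial.C F) (Polynomial.C G)).coeff 0 = F * G ∧
      (∀ r : ℕ, 1 ≤ r →
        (Su2.odot Su2.star (Polynomial.C F) (Polynomial.C G)).coeff (2 * r) =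
          Su2.eta Su2.L Su2.dN r (F * G)) ∧
      (∀ r : ℕ, (Su2.odot Su2.star (Polynomial.C F) (Polynomial.C G)).coeff (2 * r + 1) = 0)) ∧
    -- strongly non-trivial, weakly trivial
    ¬ Su2.StronglyTrivial (Su2.odot Su2.star) ∧
    Su2.WeaklyTrivial (Su2.odot Su2.star) ∧
    -- the unique extension to smooth functions; it is given by the same differential operators,
    -- and it is an Abelian associative product
    (∃ B : Su2.Smooth → Su2.Smooth → PowerSeries Su2.Smooth,
      Su2.IsSmoothExtension (Su2.odot Su2.star) B ∧
      (∀ B', Su2.IsSmoothExtension (Su2.odot Su2.star) B' → B' = B) ∧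
      (∀ f g : Su2.Smooth,
        PowerSeries.coeff 0 (B f g) = f * g ∧
        (∀ r : ℕ, 1 ≤ r →
          PowerSeries.coeff (2 * r) (B f g) = Su2.eta Su2.coordS Su2.dS r (f * g)) ∧
        (∀ r : ℕ, PowerSeries.coeff (2 * r + 1) (B f g) = 0)) ∧
      (∀ F G : Su2.Nν, Su2.annihilate B (Su2.embed F) (Su2.embed G) =
        Su2.embed (Su2.odot Su2.star F G)) ∧
      (∀ f g : PowerSeries Su2.Smooth, Su2.annihilate B f g = Su2.annihilate B g f) ∧
      (∀ f g h : PowerSeries Su2.Smooth,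
        Su2.annihilate B (Su2.annihilate B f g) h =
          Su2.annihilate B f (Su2.annihilate B g h))) := by
  refine ⟨Su2.pull_star, fun m => ⟨fun h => ?_, ?_⟩, Su2.star_isInvariant,
    Su2.star_isStarProduct.existsUnique_symmetrization,
    fun r _ => Su2.isDiffOp_of_mem (Su2.isPartials_dN.eta_mem Su2.L r), fun F G => ⟨?_, ?_, ?_⟩,
    Su2.not_stronglyTrivial, Su2.weaklyTrivial, Su2.smoothOdot, Su2.isSmoothExtension_smoothOdot,
    fun _ => Su2.eq_smoothOdot, fun f g => ⟨?_, ?_, ?_⟩, ?_, ?_, ?_⟩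
  · exact h.1.eq_of_hasLProduct h.2 Su2.star_isStarProduct Su2.star_hasLProduct
  · rintro rfl
    exact ⟨Su2.star_isStarProduct, Su2.star_hasLProduct⟩
  · simpa [Su2.eta_zero] using (Su2.coeff_odot F G 0).1
  · exact fun r _ => (Su2.coeff_odot F G r).1
  · exact fun r => (Su2.coeff_odot F G r).2
  · exact Su2.coeff_zero_smoothOdot f g
  · exact fun r _ => Su2.coeff_even_smoothOdot f g r
  · exact Su2.coeff_odd_smoothOdot f g
  · intro F G
    rw [Su2.annihilate, Su2.coeff_embed, Su2.coeff_embed, Su2.smoothOdot_toSmooth, Su2.odot_eq,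
      Su2.odot_eq, Polynomial.coeff_C_zero, Polynomial.coeff_C_zero]
  · intro f g
    simp only [Su2.annihilate, Su2.smoothOdot, mul_comm]
  · intro f g h
    simp only [Su2.annihilate, Su2.coeff_zero_smoothOdot]
    simp only [Su2.smoothOdot, mul_assoc]
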